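/- Let $\mathcal S$ be a finite-dimensional commutative associative real algebra with identity, let $\mathcal S_c=\mathcal S\oplus i\mathcal S$ be its complexification, with conjugation $\overline{X+iY}=X-iY$ and $\mathrm{Re}(X+iY)=X$, $\mathrm{Im}(X+iY)=Y$ for $X,Y\in\mathcal S$. Let $$\mathcal Q=\{(Z,W)\in\mathcal S_c\times\mathcal S_c:\ \mathrm{Im}\,W=Z^2\bar Z^2\}$$ be the $\mathcal S$-algebraization of the hypersurface $\{\mathrm{Im}\,w=z^2\bar z^2\}\subset\mathbb C^2$, regarded as a real submanifold of the complex vector space $\mathcal S_c\times\mathcal S_c$. Then: (a) $\mathcal Q$ is nondegenerate. That is, the real coordinates, in any basis of $\mathcal S$, of the $\mathcal S$-valued form $Z\mapsto Z^2\bar Z^2$ are linearly independent over $\mathbb R$, and $\mathcal Q$ is of finite type at each of its points (the iterated Lie brackets of smooth sections of its complex tangent bundle span its tangent space); and $\mathcal Q$ is holomorphically nondegenerate at each of its points (there is no nonzero germ of a holomorphic vector field of type $(1,0)$ on $\mathcal S_c\times\mathcal S_c$ tangent to $\mathcal Q$). (b) $\mathcal Q$ satisfies the full-dimension condition (fd):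 the image of the map $\mathcal S_c\times\mathcal S_c\to\mathcal S_c$, $(Z,\zeta)\mapsto Z^2\zeta^2$, has interior points. (c) Let $\mathrm{aut}\,\mathcal Q$ be the Lie algebra of the fields $X=2\,\mathrm{Re}\big(f(Z,W)\frac{\partial}{\partial Z}+g(Z,W)\frac{\partial}{\partial W}\big)$ with $f,g$ holomorphic in a neighbourhood of the origin that are tangent to $\mathcal Q$ near the origin. Every field $X\in\mathrm{aut}\,\mathcal Q$ has, near the origin, the form $$X=2\,\mathrm{Re}\Big(\big(\lambda(Z)+B(W,Z)\big)\frac{\partial}{\partial Z}+\big(q+\rho(W)+r(W,W)\big)\frac{\partial}{\partial W}\Big),$$ where $q\in\mathcal S$, the maps $\lambda,\rho:\mathcal S_c\to\mathcal S_c$ are $\mathbb C$-linear, the maps $B,r:\mathcal S_c\times\mathcal S_c\to\mathcal S_c$ are $\mathbb C$-bilinear, $r$ is symmetric, $\rho(U)\in\mathcal S$ and $r(U,U)\in\mathcal S$ for $U\in\mathcal S$, and for all $Z\in\mathcal S_c$, $U\in\mathcal S$ $$4\,\mathrm{Re}\big(\lambda(Z)\,Z\bar Z^2\big)=\rho(Z^2\bar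 Z^2),\qquad 2\,\mathrm{Re}\big(B(U,Z)\,Z\bar Z^2\big)=r(U,Z^2\bar Z^2),\qquad \mathrm{Im}\big(B(Z^2\bar Z^2,Z)\,Z\bar Z^2\big)=0.$$ Conversely, every field of this form satisfying these relations belongs to $\mathrm{aut}\,\mathcal Q$. -/

import Mathlib

open scoped Topology ContDiff ComplexConjugate

noncomputable section

/-! ### The complexification of a real commutative algebra -/

/-- The complexification `S ⊕ i S` of a real commutative algebra `S`; an element is
`Z = X + i Y` with `X = Z.re` and `Y = Z.im` in `S`. -/
@[ext]
structure Cplx (S : Type*) where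
  re : S
  im : S

namespace Cplx

variable {S : Type*} [CommRing S]

/-- The inclusion of the real elements, `X ↦ X + i 0`. -/
def ofReal (x : S) : Cplx S := ⟨x, 0⟩

instance : Zero (Cplx S) := ⟨⟨0, 0⟩⟩
instance : One (Cplx S) := ⟨⟨1, 0⟩⟩
instance : Add (Cplx S) := ⟨fun a b => ⟨a.re + b.re, a.im + b.im⟩⟩
instance : Neg (Cplx S) := ⟨fun a => ⟨-a.re, -a.im⟩⟩
instance : Mul (Cplx S) :=
  ⟨fun a b => ⟨a.re * b.re - a.im * b.im, a.re * b.im + a.im * b.re⟩⟩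

@[simp] theorem ofReal_re (x : S) : (ofReal x).re = x := rfl
@[simp] theorem ofReal_im (x : S) : (ofReal x).im = 0 := rfl
@[simp] theorem zero_re : (0 : Cplx S).re = 0 := rfl
@[simp] theorem zero_im : (0 : Cplx S).im = 0 := rfl
@[simp] theorem one_re : (1 : Cplx S).re = 1 := rfl
@[simp] theorem one_im : (1 : Cplx S).im = 0 := rfl
@[simp] theorem add_re (a b : Cplx S) : (a + b).re = a.re + b.re := rfl
@[simp] theorem add_im (a b : Cplx S) : (a + b).im = a.im + b.im := rfl
@[simp] theorem neg_re (a : Cplx S) : (-a).re = -a.re := rfl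
@[simp] theorem neg_im (a : Cplx S) : (-a).im = -a.im := rfl
@[simp] theorem mul_re (a b : Cplx S) : (a * b).re = a.re * b.re - a.im * b.im := rfl
@[simp] theorem mul_im (a b : Cplx S) : (a * b).im = a.re * b.im + a.im * b.re := rfl

instance : CommRing (Cplx S) where
  add_assoc a b c := by ext <;> simp [add_assoc]
  zero_add a := by ext <;> simp
  add_zero a := by ext <;> simp
  add_comm a b := by ext <;> simp [add_comm]
  neg_add_cancel a := by ext <;> simp
  mul_assoc a b c := by ext <;> simp <;> ring
  one_mul a := by ext <;> simp
  mul_one a := by ext <;> simp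
  mul_comm a b := by ext <;> simp <;> ring
  left_distrib a b c := by ext <;> simp <;> ring
  right_distrib a b c := by ext <;> simp <;> ring
  zero_mul a := by ext <;> simp
  mul_zero a := by ext <;> simp
  nsmul := nsmulRec
  zsmul := zsmulRec

@[simp] theorem sub_re (a b : Cplx S) : (a - b).re = a.re - b.re := by
  rw [sub_eq_add_neg, add_re, neg_re, sub_eq_add_neg]
@[simp] theorem sub_im (a b : Cplx S) : (a - b).im = a.im - b.im := by
  rw [sub_eq_add_neg, add_im, neg_im, sub_eq_add_neg]

/-- Complex conjugation `X + i Y ↦ X - i Y`, written `conj Z`. -/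
instance : StarRing (Cplx S) where
  star a := ⟨a.re, -a.im⟩
  star_involutive a := by ext <;> simp
  star_mul a b := by ext <;> simp <;> ring
  star_add a b := by ext <;> simp; ring

@[simp] theorem conj_re (a : Cplx S) : (conj a).re = a.re := rfl
@[simp] theorem conj_im (a : Cplx S) : (conj a).im = -a.im := rfl

variable [Algebra ℝ S]

/-- The inclusion of the complex scalars, `x + i y ↦ x 1 + i (y 1)`. -/
def ofComplex : ℂ →+* Cplx S where
  toFun c := ⟨algebraMap ℝ S c.re, algebraMap ℝ S c.im⟩
  map_one' := by ext <;> simp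
  map_mul' a b := by ext <;> simp
  map_zero' := by ext <;> simp
  map_add' a b := by ext <;> simp

instance : Algebra ℂ (Cplx S) where
  smul c a := ⟨c.re • a.re - c.im • a.im, c.re • a.im + c.im • a.re⟩
  algebraMap := ofComplex
  commutes' a b := mul_comm _ _
  smul_def' c a := by
    change (⟨c.re • a.re - c.im • a.im, c.re • a.im + c.im • a.re⟩ : Cplx S) = _
    ext <;> simp [ofComplex, Algebra.smul_def]

@[simp] theorem smul_re (c : ℂ) (a : Cplx S) : (c • a).re = c.re • a.re - c.im • a.im := rfl
@[simp] theorem smul_im (c : ℂ) (a : Cplx S) : (c • a).im = c.re • a.im + c.im • a.re := rfl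

theorem real_smul_re (c : ℝ) (a : Cplx S) : (c • a).re = c • a.re := by
  change ((c : ℂ) • a).re = _
  rw [smul_re]
  simp

theorem real_smul_im (c : ℝ) (a : Cplx S) : (c • a).im = c • a.im := by
  change ((c : ℂ) • a).im = _
  rw [smul_im]
  simp

variable [FiniteDimensional ℝ S]

instance : FiniteDimensional ℂ (Cplx S) := by
  let e : (S × S) →ₗ[ℝ] Cplx S :=
    { toFun := fun p => ⟨p.1, p.2⟩
      map_add' := fun p q => rfl
      map_smul' := fun c p => by ext <;> simp [real_smul_re, real_smul_im] }
  have : Module.Finite ℝ (Cplx S) :=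
    Module.Finite.of_surjective e (fun a => ⟨(a.re, a.im), rfl⟩)
  exact Module.Finite.of_restrictScalars_finite ℝ ℂ (Cplx S)

/-- The realization of the complexified algebra by matrices (multiplication operators in a
basis). -/
def toMatrix : Cplx S →ₐ[ℂ] Matrix (Fin (Module.finrank ℂ (Cplx S)))
    (Fin (Module.finrank ℂ (Cplx S))) ℂ :=
  Algebra.leftMulMatrix (Module.finBasis ℂ (Cplx S))

section Norm

attribute [local instance] Matrix.linftyOpNormedRing Matrix.linftyOpNormedAlgebra

/-- A submultiplicative norm: the operator norm in the realization by matrices. All norms on this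
finite-dimensional space are equivalent, so that only its topology matters below. -/
instance : NormedCommRing (Cplx S) :=
  NormedCommRing.induced (Cplx S) _ (toMatrix (S := S))
    (Algebra.leftMulMatrix_injective (Module.finBasis ℂ (Cplx S)))

instance : NormedAlgebra ℂ (Cplx S) :=
  NormedAlgebra.induced ℂ (Cplx S) _ (toMatrix (S := S))

end Norm

end Cplx

/-! ### Real submanifolds of a complex vector space given by a defining function -/

section CR

variable {E F : Type*} [NormedAddCommGroup E] [NormedSpace ℂ E]
  [NormedAddCommGroup F] [NormedSpace ℝ F]

/-- The tangent space at `p` of the submanifold `{ρ = 0}`: the kernel of `dρ` at `p`. -/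
def tangentAt (ρ : E → F) (p : E) : Submodule ℝ E :=
  LinearMap.ker (fderiv ℝ ρ p : E →ₗ[ℝ] F)

/-- The vectors `v` such that `v` and `i v` are both tangent to `{ρ = 0}` at `p` (the complex
tangent space). Equivalently, the `(1,0)`-vector with components `v` annihilates `ρ`. -/
def complexTangentAt (ρ : E → F) (p : E) : Set E :=
  {v | v ∈ tangentAt ρ p ∧ Complex.I • v ∈ tangentAt ρ p}

/-- The holomorphic vector fields in a neighbourhood of the origin tangent to `{ρ = 0}`. The real
field `2 Re (∑ X_j ∂/∂z_j)` is, as a vector-valued map, the holomorphic map `X`; fields are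
regarded as germs at the origin. -/
def infAut (ρ : E → F) : Set (E → E) :=
  {X | AnalyticAt ℂ X 0 ∧ ∀ᶠ p in 𝓝 (0 : E), ρ p = 0 → X p ∈ tangentAt ρ p}

/-- Holomorphic nondegeneracy of `{ρ = 0}` at `p`: there is no nonzero germ at `p` of a
holomorphic `(1,0)`-field `∑ X_j ∂/∂z_j` tangent to `{ρ = 0}`. -/
def HolNondegenerateAt (ρ : E → F) (p : E) : Prop :=
  ∀ X : E → E, AnalyticAt ℂ X p →
    (∀ᶠ q in 𝓝 p, ρ q = 0 → X q ∈ complexTangentAt ρ q) → ∀ᶠ q in 𝓝 p, X q = 0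

/-- The iterated Lie brackets of smooth sections of the complex tangent bundle of `{ρ = 0}`
(extended smoothly to the ambient space). -/
inductive IsIteratedBracket (ρ : E → F) : (E → E) → Prop
  | of_section (V : E → E) (hV : ContDiff ℝ ∞ V)
      (hT : ∀ p, ρ p = 0 → V p ∈ complexTangentAt ρ p) : IsIteratedBracket ρ V
  | bracket (V W : E → E) (hV : IsIteratedBracket ρ V) (hW : IsIteratedBracket ρ W) :
      IsIteratedBracket ρ (VectorField.lieBracket ℝ V W)

/-- Finite type at `p`: the iterated brackets of sections of the complex tangent bundle span the
tangent space at `p`. -/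
def FiniteTypeAt (ρ : E → F) (p : E) : Prop :=
  tangentAt ρ p ≤ Submodule.span ℝ {v | ∃ V, IsIteratedBracket ρ V ∧ V p = v}

end CR

/-- The coordinates of a map `φ` into the finite-dimensional real space `S ≃ ℝ^l`, in any basis,
are linearly independent over `ℝ` as functions. -/
def CoordinatesIndependent {V S : Type*} [AddCommGroup S] [Module ℝ S] (φ : V → S) : Prop :=
  ∀ b : Module.Basis (Fin (Module.finrank ℝ S)) ℝ S,
    LinearIndependent ℝ (fun j => fun Z : V => b.repr (φ Z) j)

/-! ### Algebraization -/

/-- The `S`-algebraization of a polynomial `P(z, z̄)` on `ℂ^N`: the variables `z_j` (index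
`Sum.inl j`) and `z̄_j` (index `Sum.inr j`) are replaced by `Z_j` and its conjugate, where `Z_j`
is in the complexification of `S`. Here `P` is real-valued on `ℂ^N`. The algebraization of the
real algebraic set `{P = 0}` is the zero set of this map. -/
def algebraize (S : Type*) [CommRing S] [Algebra ℝ S] {N : ℕ}
    (P : MvPolynomial (Fin N ⊕ Fin N) ℂ) (Z : Fin N → Cplx S) : Cplx S :=
  MvPolynomial.aeval (Sum.elim Z (fun j => conj (Z j))) P

/-- The polynomial `Im w - z² z̄²` in `z, w, z̄, w̄`, where `z` has index `0` and `w` has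
index `1`. -/
def quarticPoly : MvPolynomial (Fin 2 ⊕ Fin 2) ℂ :=
  MvPolynomial.C (1 / (2 * Complex.I)) *
      (MvPolynomial.X (Sum.inl 1) - MvPolynomial.X (Sum.inr 1)) -
    MvPolynomial.X (Sum.inl 0) ^ 2 * MvPolynomial.X (Sum.inr 0) ^ 2

/-- The full-dimension condition `(fd)` for a form `Φ`: the image of `(z, ζ) ↦ Φ(z, z, ζ, ζ)` has
interior points. -/
def FullDimension {V V' : Type*} [TopologicalSpace V'] (Φ : V → V → V') : Prop :=
  (interior (Set.range (fun p : V × V => Φ p.1 p.2))).Nonempty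

section Quartic

variable (S : Type*) [CommRing S] [Algebra ℝ S]

/-- The defining function of the algebraization `𝒬` of `Im w = z² z̄²`, in the coordinates
`(Z, W)`. -/
def quarticFun (p : Cplx S × Cplx S) : Cplx S := algebraize S quarticPoly ![p.1, p.2]

/-- The algebraization `𝒬` of `Im w = z² z̄²`. -/
def quartic : Set (Cplx S × Cplx S) := {p | quarticFun S p = 0}

/-- The form `Φ(z, z, ζ, ζ) = z² ζ²` of the surface `Im W = Φ(Z, Z, Z̄, Z̄)`, with the conjugate
replaced by an independent variable. -/
def quarticForm (Z ζ : Cplx S) : Cplx S := Z ^ 2 * ζ ^ 2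

variable {S}

theorem quarticFun_eq (p : Cplx S × Cplx S) :
    quarticFun S p = Cplx.ofReal p.2.im - quarticForm S p.1 (conj p.1) := by
  have h : (1 / (2 * Complex.I)) = ⟨0, -1 / 2⟩ := by
    apply Complex.ext <;> simp
    norm_num
  have h2 : (MvPolynomial.aeval (Sum.elim ![p.1, p.2] fun j => conj (![p.1, p.2] j)))
      (MvPolynomial.C (σ := Fin 2 ⊕ Fin 2) (1 / (2 * Complex.I)) *
      (MvPolynomial.X (Sum.inl 1) - MvPolynomial.X (Sum.inr 1))) = Cplx.ofReal p.2.im := by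
    rw [h, ← MvPolynomial.smul_eq_C_mul, map_smul]
    ext
    · have h3 : p.2.im + p.2.im = (2 : ℝ) • p.2.im := (two_smul ℝ p.2.im).symm
      simp only [map_sub, MvPolynomial.aeval_X, Sum.elim_inl, Sum.elim_inr, Cplx.smul_re,
        Cplx.sub_im, Cplx.conj_im, Matrix.cons_val_one, Matrix.cons_val_fin_one, zero_smul,
        sub_neg_eq_add, h3, smul_smul, Cplx.ofReal_re]
      norm_num
    · simp
  simp only [quarticFun, algebraize, quarticPoly, quarticForm, map_sub, h2]
  simp

theorem mem_quartic_iff (p : Cplx S × Cplx S) :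
    p ∈ quartic S ↔ Cplx.ofReal p.2.im = p.1 ^ 2 * conj p.1 ^ 2 := by
  rw [quartic, Set.mem_ofPred_eq, quarticFun_eq, sub_eq_zero, quarticForm]

end Quartic

/-- The form is real on the diagonal, so that `Φ(Z, Z, Z̄, Z̄)` is the element
`(quarticForm S Z (conj Z)).re` of `S`. -/
theorem quarticForm_conj_im {S : Type*} [CommRing S] (Z : Cplx S) : (quarticForm S Z (conj Z)).im = 0 := by
  simp [quarticForm, pow_two]
  ring

end

/-!
On `𝒬` one has `W̄ = W - 2i Z² Z̄²`. By the identity principle for totally real subspaces, the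
tangency equation of a field remains true with `Z̄` replaced by an independent variable `ζ`.
At `ζ = 0` and `Z = 0` it shows that the second component depends only on `W`. The points
`(Z, ζ)` and `(t Z, t⁻¹ ζ)` have the same `Z² ζ²`; comparing the equations there to second order
in `ζ` shows that the first component is linear in `Z`. Now let `W` and `W - 2i Z² ζ²` be the
points `x Z² ζ²` and `y Z² ζ²` of a complex line: the equation expresses a difference quotient
`(g(x) - g(y)) / (x - y)` as `a(x) + b(y)`, which makes the first component affine and the second
quadratic in `W`. As squares fill a neighbourhood of `1`, these lines fill an open set.

The relations between the coefficients are found by comparing powers of `s` along the curves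
`s ↦ (s Z, s U + i s⁴ Z² Z̄²)` in `𝒬`. For holomorphic nondegeneracy, the complex tangency
condition is polarized in the same way. For finite type, brackets of up to four sections
`(c, 4i c Z Z̄²)` with constant `c` already fill the missing directions, those of real `W`.
-/

noncomputable section

section IdentityPrinciples

variable {E G : Type*} [NormedAddCommGroup E] [NormedSpace ℂ E] [NormedAddCommGroup G]
  [NormedSpace ℂ G] [CompleteSpace G] {H : E → G}

theorem eq_zero_of_frequently_eq_zero_on_line {p : E} {ε : ℝ}
    (hH : DifferentiableOn ℂ H (Metric.ball p ε)) {a v : E} (ha : a ∈ Metric.ball p ε)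
    (h : ∃ᶠ s : ℂ in 𝓝[≠] 0, H (a + s • v) = 0) {t : ℂ} (ht : a + t • v ∈ Metric.ball p ε) :
    H (a + t • v) = 0 := by
  have hline : Differentiable ℂ fun s : ℂ => a + s • v := by fun_prop
  have hopen : IsOpen ((fun s : ℂ => a + s • v) ⁻¹' Metric.ball p ε) :=
    Metric.isOpen_ball.preimage hline.continuous
  have hconvex : Convex ℝ ((fun s : ℂ => a + s • v) ⁻¹' Metric.ball p ε) :=
    ((convex_ball p ε).translate_preimage_right a).linear_preimage
      ((LinearMap.toSpanSingleton ℂ E v).restrictScalars ℝ)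
  have hanalytic : AnalyticOnNhd ℂ (fun s : ℂ => H (a + s • v))
      ((fun s : ℂ => a + s • v) ⁻¹' Metric.ball p ε) :=
    (hH.comp hline.differentiableOn (Set.mapsTo_preimage _ _)).analyticOnNhd hopen
  exact hanalytic.eqOn_zero_of_preconnected_of_frequently_eq_zero hconvex.isPreconnected
    (by simpa using ha) h ht

theorem eventually_eq_zero_of_eventually_eq_zero_on_fixedPoints {σ : E →L[ℝ] E}
    (hσI : ∀ v, σ (Complex.I • v) = -(Complex.I • σ v)) (hσσ : ∀ v, σ (σ v) = v) {p : E}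
    (hp : σ p = p) (hH : ∀ᶠ v in 𝓝 p, DifferentiableAt ℂ H v)
    (h : ∀ᶠ v in 𝓝 p, σ v = v → H v = 0) : ∀ᶠ v in 𝓝 p, H v = 0 := by
  obtain ⟨ε, hε, hball⟩ := Metric.eventually_nhds_iff_ball.1 (hH.and h)
  have hdecomp (q : E) :
      ∃ u w, σ u = u ∧ σ w = w ∧ u + Complex.I • w = q ∧ u = (2⁻¹ : ℝ) • (q + σ q) := by
    refine ⟨(2⁻¹ : ℝ) • (q + σ q), -(Complex.I • (2⁻¹ : ℝ) • (q - σ q)), ?_, ?_, ?_, rfl⟩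
    · simp only [map_smul, map_add, hσσ, add_comm]
    · simp only [map_neg, hσI, map_smul, map_sub, hσσ]
      module
    · simp only [smul_neg, smul_smul, Complex.I_mul_I]
      module
  have hre : Filter.Tendsto (fun q => (2⁻¹ : ℝ) • (q + σ q)) (𝓝 p) (𝓝 p) :=
    Continuous.tendsto' (by fun_prop) p p (by simp only [hp]; module)
  filter_upwards [Metric.ball_mem_nhds p hε, hre (Metric.ball_mem_nhds p hε)] with q hq hu
  obtain ⟨u, w, hσu, hσw, rfl, hu_eq⟩ := hdecomp q
  rw [Set.mem_preimage, ← hu_eq] at hu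
  have hreal : Filter.Tendsto (fun s : ℝ => (s : ℂ)) (𝓝[≠] 0) (𝓝[≠] 0) :=
    tendsto_nhdsWithin_iff.2 ⟨(Complex.continuous_ofReal.tendsto' 0 0 rfl).mono_left
      nhdsWithin_le_nhds, eventually_nhdsWithin_of_forall fun s hs => Complex.ofReal_ne_zero.2 hs⟩
  have hline : Filter.Tendsto (fun s : ℝ => u + s • w) (𝓝[≠] 0) (𝓝 u) :=
    (Continuous.tendsto' (by fun_prop) 0 _ (by simp)).mono_left nhdsWithin_le_nhds
  refine eq_zero_of_frequently_eq_zero_on_line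
    (fun v hv => (hball v hv).1.differentiableWithinAt) hu
    (hreal.frequently (Filter.Eventually.frequently ?_)) hq
  filter_upwards [hline (Metric.isOpen_ball.mem_nhds hu)] with s hs
  exact (hball (u + s • w) hs).2 (by rw [map_add, map_smul, hσu, hσw])

theorem eventually_eq_zero_of_frequently_eq_zero_smul {v₀ : E}
    (hH : ∀ᶠ v in 𝓝 0, DifferentiableAt ℂ H v)
    (h : ∀ᶠ v in 𝓝 v₀, ∃ᶠ s : ℂ in 𝓝[≠] 0, H (s • v) = 0) : ∀ᶠ v in 𝓝 0, H v = 0 := by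
  obtain ⟨ε, hε, hball⟩ := Metric.eventually_nhds_iff_ball.1 hH
  have hdiff : DifferentiableOn ℂ H (Metric.ball 0 ε) :=
    fun v hv => (hball v hv).differentiableWithinAt
  have hsmul : Filter.Tendsto (fun s : ℂ => s • v₀) (𝓝[≠] 0) (𝓝 0) :=
    (Continuous.tendsto' (by fun_prop) 0 0 (zero_smul ℂ v₀)).mono_left nhdsWithin_le_nhds
  have hne : ∀ᶠ s : ℂ in 𝓝[≠] 0, s ≠ 0 := eventually_mem_nhdsWithin
  obtain ⟨s, hs, hs0⟩ := ((hsmul.eventually_mem (Metric.ball_mem_nhds 0 hε)).and hne).exists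
  have hcone : ∀ᶠ v in 𝓝 (s • v₀), H v = 0 := by
    have hinv : Filter.Tendsto (fun v : E => s⁻¹ • v) (𝓝 (s • v₀)) (𝓝 v₀) :=
      (continuous_const_smul s⁻¹).tendsto' _ _ (inv_smul_smul₀ hs0 v₀)
    filter_upwards [hinv.eventually h, Metric.isOpen_ball.mem_nhds hs] with v hv hvε
    have := eq_zero_of_frequently_eq_zero_on_line hdiff
      (Metric.mem_ball_self hε) (v := s⁻¹ • v) (t := s) (by simpa using hv)
      (by simpa [smul_inv_smul₀ hs0] using hvε)
    simpa [smul_inv_smul₀ hs0] using this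
  filter_upwards [Metric.ball_mem_nhds 0 hε] with v hv
  have hline : Filter.Tendsto (fun t : ℂ => s • v₀ + t • (v - s • v₀)) (𝓝[≠] 0) (𝓝 (s • v₀)) :=
    (Continuous.tendsto' (by fun_prop) 0 _ (by simp)).mono_left nhdsWithin_le_nhds
  have hone : s • v₀ + (1 : ℂ) • (v - s • v₀) = v := by rw [one_smul, add_sub_cancel]
  rw [← hone] at hv ⊢
  exact eq_zero_of_frequently_eq_zero_on_line hdiff hs
    (hline.eventually hcone).frequently hv

end IdentityPrinciples

theorem smul_sub_comm_of_sub_eq_smul_add {𝕜 F : Type*} [Field 𝕜] [CharZero 𝕜] [AddCommGroup F]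
    [Module 𝕜 F] {a b h : 𝕜 → F} {t : Set 𝕜} (h0 : 0 ∈ t)
    (hab : ∀ x ∈ t, ∀ y ∈ t, h x - h y = (2 * (x - y)) • (a x + b y)) {x y : 𝕜} (hx : x ∈ t)
    (hy : y ∈ t) : x • (a y - a 0) = y • (a x - a 0) := by
  have hb : b y = a y + b 0 - a 0 := by
    rcases eq_or_ne y 0 with rfl | hy0
    · rw [add_sub_cancel_left]
    refine smul_right_injective F (mul_ne_zero two_ne_zero hy0) ?_
    linear_combination (norm := module) hab y hy 0 h0 + hab 0 h0 y hy
  have hxy := hab x hx y hy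
  rw [hb] at hxy
  refine smul_right_injective F (two_ne_zero (α := 𝕜)) ?_
  linear_combination (norm := module) hab x hx 0 h0 - hab y hy 0 h0 - hxy

theorem eventually_eq_taylor_of_sub_eq_smul_add {𝕜 F : Type*} [NontriviallyNormedField 𝕜]
    [CharZero 𝕜] [NormedAddCommGroup F] [NormedSpace 𝕜 F] {a b h : 𝕜 → F} {a' h' : F}
    (ha : HasDerivAt a a' 0) (hh : HasDerivAt h h' 0)
    (hab : ∀ᶠ v : 𝕜 × 𝕜 in 𝓝 0, h v.1 - h v.2 = (2 * (v.1 - v.2)) • (a v.1 + b v.2)) :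
    ∀ᶠ x in 𝓝 0, a x = a 0 + x • a' ∧ h x = h 0 + x • h' + x ^ 2 • (2 : 𝕜) • a' := by
  rw [← Prod.mk_zero_zero, nhds_prod_eq] at hab
  obtain ⟨t, ht, hab⟩ := Filter.eventually_prod_self_iff'.1 hab
  have h0 : (0 : 𝕜) ∈ t := mem_of_mem_nhds ht
  have hlinear : ∀ x ∈ t, a x = a 0 + x • a' := by
    intro x hx
    have hleft : HasDerivAt (fun y => x • (a y - a 0)) (x • a') 0 := (ha.sub_const _).const_smul x
    have hright : HasDerivAt (fun y : 𝕜 => y • (a x - a 0)) (a x - a 0) 0 := by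
      simpa using (hasDerivAt_id (0 : 𝕜)).smul_const (a x - a 0)
    have heq : ∀ᶠ y in 𝓝 0, x • (a y - a 0) = y • (a x - a 0) :=
      Filter.eventually_of_mem ht fun y hy => smul_sub_comm_of_sub_eq_smul_add h0 hab hx hy
    rw [hleft.unique (hright.congr_of_eventuallyEq heq), add_sub_cancel]
  have hquad : ∀ x ∈ t, h x = h 0 + x • (2 : 𝕜) • (a 0 + b 0) + x ^ 2 • (2 : 𝕜) • a' := by
    intro x hx
    have hx0 := hab x hx 0 h0
    rw [hlinear x hx] at hx0
    linear_combination (norm := module) hx0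
  have hderiv : HasDerivAt h ((2 : 𝕜) • (a 0 + b 0)) 0 := by
    have hpoly := (((hasDerivAt_id (0 : 𝕜)).smul_const ((2 : 𝕜) • (a 0 + b 0))).const_add (h 0)).add
      (((hasDerivAt_id (0 : 𝕜)).pow 2).smul_const ((2 : 𝕜) • a'))
    simpa using hpoly.congr_of_eventuallyEq (Filter.eventually_of_mem ht hquad)
  rw [hh.unique hderiv]
  exact Filter.eventually_of_mem ht fun x hx => ⟨hlinear x hx, hquad x hx⟩

section BanachAlgebra

variable {A : Type*} [NormedCommRing A] [NormedAlgebra ℂ A]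

theorem eventually_exists_sq_eq [CompleteSpace A] : ∀ᶠ a in 𝓝 (1 : A), ∃ b : A, b ^ 2 = a := by
  have hderiv := (hasStrictFDerivAt_id (𝕜 := ℂ) (1 : A)).pow 2
  have hsurj : Function.Surjective ((2 • (1 : A) ^ (2 - 1)) • ContinuousLinearMap.id ℂ A) := by
    refine fun a => ⟨(2⁻¹ : ℂ) • a, ?_⟩
    simp only [Nat.add_one_sub_one, one_pow, smul_apply,
      ContinuousLinearMap.id_apply, smul_eq_mul, mul_smul_comm, smul_mul_assoc, one_mul]
    module
  have hmap := hderiv.map_nhds_eq_of_surj (LinearMap.range_eq_top.2 hsurj)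
  rw [← one_pow (M := A) 2]
  exact hmap ▸ Filter.eventually_map.2 (Filter.Eventually.of_forall fun b => ⟨b, rfl⟩)

theorem eventually_exists_units_sq_mul_sq_eq [CompleteSpace A] :
    ∀ᶠ v : A × A in 𝓝 (1, 1), IsUnit v.1 ∧ ∃ ζ, IsUnit ζ ∧ v.1 ^ 2 * ζ ^ 2 = v.2 := by
  have hfst := (continuous_fst (X := A) (Y := A)).tendsto (1, 1)
  have hsnd := (continuous_snd (X := A) (Y := A)).tendsto (1, 1)
  have hunit : ∀ᶠ a in 𝓝 (1 : A), IsUnit a := Units.isOpen.mem_nhds isUnit_one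
  filter_upwards [hfst.eventually hunit, hsnd.eventually hunit,
    hsnd.eventually eventually_exists_sq_eq]
  rintro ⟨_, V⟩ ⟨Z, rfl⟩ hV ⟨η, rfl : η ^ 2 = V⟩
  have hη : IsUnit η := (isUnit_pow_iff two_ne_zero).1 hV
  refine ⟨Z.isUnit, η * ↑Z⁻¹, hη.mul Z⁻¹.isUnit, ?_⟩
  rw [← mul_pow, mul_left_comm, Units.mul_inv, mul_one]

/-- The tangency equation of the field `f ∂/∂Z + G(W) ∂/∂W` to `W - W̄ = c Z² Z̄²`, polarized:
`(Z, W)` and `(Z̄, W̄)` become the independent points `(Z, P)` and `(ζ, P - c Z² ζ²)` of the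
complexified hypersurface, and the conjugate of `f` becomes a second map `f'`. -/
def PolarizedTangency (c : ℂ) (f f' : A × A → A) (G : A → A) : Prop :=
  ∀ᶠ v : A × A × A in 𝓝 0,
    G v.2.2 - G (v.2.2 - c • (v.1 ^ 2 * v.2.1 ^ 2)) =
      (2 * c) • (f (v.1, v.2.2) * (v.1 * v.2.1 ^ 2) +
        f' (v.2.1, v.2.2 - c • (v.1 ^ 2 * v.2.1 ^ 2)) * (v.2.1 * v.1 ^ 2))

theorem polarizedTangency_of_eventually {c : ℂ} {f g f' g' : A × A → A}
    (h : ∀ᶠ v : A × A × A in 𝓝 0,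
      g (v.1, v.2.2) - g' (v.2.1, v.2.2 - c • (v.1 ^ 2 * v.2.1 ^ 2)) =
        (2 * c) • (f (v.1, v.2.2) * (v.1 * v.2.1 ^ 2) +
          f' (v.2.1, v.2.2 - c • (v.1 ^ 2 * v.2.1 ^ 2)) * (v.2.1 * v.1 ^ 2))) :
    (∀ᶠ p in 𝓝 0, g p = g (0, p.2)) ∧ PolarizedTangency c f f' fun P => g (0, P) := by
  have hζ : Filter.Tendsto (fun p : A × A => (p.1, (0 : A), p.2)) (𝓝 0) (𝓝 0) :=
    Continuous.tendsto' (by fun_prop) 0 0 rfl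
  have hZ : Filter.Tendsto (fun p : A × A => ((0 : A), p.1, p.2)) (𝓝 0) (𝓝 0) :=
    Continuous.tendsto' (by fun_prop) 0 0 rfl
  have hP : Filter.Tendsto (fun p : A × A => ((0 : A), p.2)) (𝓝 0) (𝓝 0) :=
    Continuous.tendsto' (by fun_prop) 0 0 rfl
  have hg : ∀ᶠ p in 𝓝 0, g p = g' (0, p.2) :=
    (hζ.eventually h).mono fun p hp => sub_eq_zero.1 (by simpa using hp)
  have hg' : ∀ᶠ p in 𝓝 0, g' p = g (0, p.2) :=
    (hZ.eventually h).mono fun p hp => (sub_eq_zero.1 (by simpa using hp)).symm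
  have hgg : ∀ᶠ p in 𝓝 0, g p = g (0, p.2) := by
    filter_upwards [hg, hP.eventually hg'] with p h₁ h₂ using h₁.trans h₂
  refine ⟨hgg, ?_⟩
  have hleft : Filter.Tendsto (fun v : A × A × A => (v.1, v.2.2)) (𝓝 0) (𝓝 0) :=
    Continuous.tendsto' (by fun_prop) 0 0 rfl
  have hright : Filter.Tendsto
      (fun v : A × A × A => (v.2.1, v.2.2 - c • (v.1 ^ 2 * v.2.1 ^ 2))) (𝓝 0) (𝓝 0) :=
    Continuous.tendsto' (by fun_prop) 0 0 (by simp)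
  filter_upwards [h, hleft.eventually hgg, hright.eventually hg'] with v hv h₁ h₂
  rwa [h₁, h₂] at hv

namespace PolarizedTangency

variable {c : ℂ} {f f' : A × A → A} {G : A → A}

theorem symm (h : PolarizedTangency c f f' G) : PolarizedTangency (-c) f' f G := by
  have hswap : Filter.Tendsto
      (fun v : A × A × A => (v.2.1, v.1, v.2.2 + c • (v.2.1 ^ 2 * v.1 ^ 2))) (𝓝 0) (𝓝 0) :=
    Continuous.tendsto' (by fun_prop) 0 0 (by simp)
  filter_upwards [hswap.eventually h] with v hv
  simp only [add_sub_cancel_right] at hv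
  rw [neg_smul, sub_neg_eq_add, mul_comm (v.1 ^ 2)]
  linear_combination (norm := module) -hv

end PolarizedTangency

theorem hasDerivAt_comp_smul_sub_smul {f : A × A → A} {P : A} (hf : DifferentiableAt ℂ f (0, P))
    (a : ℂ) (Z V : A) :
    HasDerivAt (fun s : ℂ => f (s • Z, P - (a * s ^ 2) • V)) (fderiv ℂ f (0, P) (Z, 0)) 0 := by
  have hfst : HasDerivAt (fun s : ℂ => s • Z) Z 0 := by
    simpa using (hasDerivAt_id (0 : ℂ)).smul_const Z
  have hsnd : HasDerivAt (fun s : ℂ => P - (a * s ^ 2) • V) 0 0 := by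
    simpa using ((((hasDerivAt_id (0 : ℂ)).pow 2).const_mul a).smul_const V).const_sub P
  have hf0 : HasFDerivAt f (fderiv ℂ f (0, P)) ((0 : ℂ) • Z, P - (a * 0 ^ 2) • V) := by
    simpa using hf.hasFDerivAt
  exact hf0.comp_hasDerivAt 0 (hfst.prodMk hsnd)

/-- The linear part in the first variable, at the points `(0, P)`, of a map of `(Z, P)`. -/
def fstDeriv (f : A × A → A) (P : A) : A →L[ℂ] A :=
  (fderiv ℂ f (0, P)).comp (ContinuousLinearMap.inl ℂ A A)

namespace PolarizedTangency

variable {c : ℂ} {f f' : A × A → A} {G : A → A}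

/- The points `(Z, ζ)` and `(t Z, t⁻¹ ζ)` give the same `Z² ζ²`, hence the same left-hand side;
for `ζ = s 1` the two right-hand sides are compared to the order `s²`. -/
theorem smul_mul_eq (hc : c ≠ 0) {Z P : A} {t : ℂ} (ht : t ≠ 0)
    (hf' : DifferentiableAt ℂ f' (0, P))
    (hZ : ∀ᶠ ζ in 𝓝 (0 : A), G P - G (P - c • (Z ^ 2 * ζ ^ 2)) = (2 * c) •
      (f (Z, P) * (Z * ζ ^ 2) + f' (ζ, P - c • (Z ^ 2 * ζ ^ 2)) * (ζ * Z ^ 2)))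
    (htZ : ∀ᶠ ζ in 𝓝 (0 : A), G P - G (P - c • ((t • Z) ^ 2 * ζ ^ 2)) = (2 * c) •
      (f (t • Z, P) * (t • Z * ζ ^ 2) +
        f' (ζ, P - c • ((t • Z) ^ 2 * ζ ^ 2)) * (ζ * (t • Z) ^ 2))) :
    f (t • Z, P) * Z = t • (f (Z, P) * Z) := by
  let φ : ℂ → A := fun s => s • (t • (f (Z, P) * Z) - f (t • Z, P) * Z)
  let ψ : ℂ → A := fun s => (t ^ 2 • f' (s • t⁻¹ • 1, P - (c * s ^ 2) • Z ^ 2) -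
    t • f' (s • 1, P - (c * s ^ 2) • Z ^ 2)) * Z ^ 2
  have hφ : HasDerivAt φ (t • (f (Z, P) * Z) - f (t • Z, P) * Z) 0 := by
    simpa using (hasDerivAt_id (0 : ℂ)).smul_const (t • (f (Z, P) * Z) - f (t • Z, P) * Z)
  have hψ : HasDerivAt ψ 0 0 := by
    have hderiv := (((hasDerivAt_comp_smul_sub_smul hf' c (t⁻¹ • 1) (Z ^ 2)).const_smul
      (t ^ 2)).sub ((hasDerivAt_comp_smul_sub_smul hf' c 1 (Z ^ 2)).const_smul t)).mul_const
      (Z ^ 2)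
    have hcancel : t ^ 2 • fderiv ℂ f' (0, P) (t⁻¹ • 1, 0) - t • fderiv ℂ f' (0, P) (1, 0) = 0 := by
      rw [← smul_zero t⁻¹, ← Prod.smul_mk, map_smul, smul_zero, smul_smul, pow_two,
        mul_inv_cancel_right₀ ht, sub_self]
    rwa [hcancel, zero_mul] at hderiv
  have hs (a : A) : Filter.Tendsto (fun s : ℂ => s • a) (𝓝[≠] 0) (𝓝 0) :=
    (Continuous.tendsto' (by fun_prop) 0 0 (zero_smul ℂ a)).mono_left nhdsWithin_le_nhds
  have hφψ : φ =ᶠ[𝓝[≠] 0] ψ := by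
    filter_upwards [(hs 1).eventually hZ, (hs (t⁻¹ • 1)).eventually htZ,
      self_mem_nhdsWithin] with s h₁ h₂ hs0
    have hV : (t • Z) ^ 2 * (s • t⁻¹ • (1 : A)) ^ 2 = Z ^ 2 * (s • (1 : A)) ^ 2 := by
      rw [smul_smul, smul_pow, smul_pow, smul_pow, smul_mul_smul_comm, mul_smul_comm, ← mul_pow,
        mul_left_comm, mul_inv_cancel₀ ht, mul_one]
    have hQ : c • (Z ^ 2 * (s • (1 : A)) ^ 2) = (c * s ^ 2) • Z ^ 2 := by
      rw [smul_pow, one_pow, mul_smul_comm, mul_one, smul_smul]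
    rw [hV, h₁, hQ] at h₂
    replace h₂ := smul_right_injective A (mul_ne_zero two_ne_zero hc) h₂
    refine smul_right_injective A hs0 ?_
    simp only [φ, ψ, smul_pow, one_pow, mul_smul_comm, smul_mul_assoc, mul_one, one_mul] at h₂ ⊢
    simp only [sub_mul, smul_mul_assoc]
    linear_combination (norm := (match_scalars <;> field_simp <;> ring)) t • h₂
  have hφψ0 : φ =ᶠ[𝓝 0] ψ :=
    (hφ.continuousAt.eventuallyEq_nhds_iff_eventuallyEq_nhdsNE hψ.continuousAt).1 hφψ
  exact (sub_eq_zero.1 (hφ.unique (hψ.congr_of_eventuallyEq hφψ0))).symm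

theorem eventually_mul_fst_eq (h : PolarizedTangency c f f' G) (hc : c ≠ 0)
    (hf : ∀ᶠ p in 𝓝 0, DifferentiableAt ℂ f p) (hf' : ∀ᶠ p in 𝓝 0, DifferentiableAt ℂ f' p) :
    ∀ᶠ p in 𝓝 0, f p * p.1 = fstDeriv f p.2 p.1 * p.1 := by
  have hreorder : Filter.Tendsto (fun q : (A × A) × A => (q.1.1, q.2, q.1.2)) (𝓝 (0, 0)) (𝓝 0) :=
    Continuous.tendsto' (by fun_prop) _ _ rfl
  have hscale : Filter.Tendsto (fun q : (A × A) × ℂ => (q.2 • q.1.1, q.1.2)) (𝓝 (0, 0)) (𝓝 0) :=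
    Continuous.tendsto' (by fun_prop) _ _ (Prod.ext (zero_smul ℂ (0 : A)) rfl)
  have hsnd : Filter.Tendsto (fun p : A × A => ((0 : A), p.2)) (𝓝 0) (𝓝 0) :=
    Continuous.tendsto' (by fun_prop) 0 0 rfl
  have heq := (hreorder.eventually h).curry_nhds
  filter_upwards [heq, (hscale.eventually heq).curry_nhds, hsnd.eventually hf,
    hsnd.eventually hf'] with p hp hscaled hfp hfp'
  have hleft : HasDerivAt (fun t : ℂ => f (t • p.1, p.2) * p.1)
      (fstDeriv f p.2 p.1 * p.1) 0 := by
    simpa [fstDeriv] using (hasDerivAt_comp_smul_sub_smul hfp 0 p.1 0).mul_const p.1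
  have hright : HasDerivAt (fun t : ℂ => t • (f p * p.1)) (f p * p.1) 0 := by
    simpa using (hasDerivAt_id (0 : ℂ)).smul_const (f p * p.1)
  have hpunctured : (fun t : ℂ => t • (f p * p.1)) =ᶠ[𝓝[≠] 0] fun t => f (t • p.1, p.2) * p.1 := by
    filter_upwards [hscaled.filter_mono nhdsWithin_le_nhds, self_mem_nhdsWithin] with t ht ht0
    exact (smul_mul_eq hc ht0 hfp' hp ht).symm
  exact hright.unique (hleft.congr_of_eventuallyEq
    ((hright.continuousAt.eventuallyEq_nhds_iff_eventuallyEq_nhdsNE hleft.continuousAt).1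
      hpunctured))

theorem linearize (h : PolarizedTangency c f f' G) (hc : c ≠ 0)
    (hf : ∀ᶠ p in 𝓝 0, DifferentiableAt ℂ f p) (hf' : ∀ᶠ p in 𝓝 0, DifferentiableAt ℂ f' p) :
    PolarizedTangency c (fun p => fstDeriv f p.2 p.1) (fun p => fstDeriv f' p.2 p.1) G := by
  have hleft : Filter.Tendsto (fun v : A × A × A => (v.1, v.2.2)) (𝓝 0) (𝓝 0) :=
    Continuous.tendsto' (by fun_prop) 0 0 rfl
  have hright : Filter.Tendsto
      (fun v : A × A × A => (v.2.1, v.2.2 - c • (v.1 ^ 2 * v.2.1 ^ 2))) (𝓝 0) (𝓝 0) :=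
    Continuous.tendsto' (by fun_prop) 0 0 (by simp)
  filter_upwards [h, hleft.eventually (h.eventually_mul_fst_eq hc hf hf'),
    hright.eventually (h.symm.eventually_mul_fst_eq (neg_ne_zero.2 hc) hf' hf)] with v hv h₁ h₂
  rwa [← mul_assoc, ← mul_assoc, h₁, h₂, mul_assoc, mul_assoc] at hv

end PolarizedTangency
theorem differentiableAt_fstDeriv [CompleteSpace A] {f : A × A → A} {P : A}
    (hf : AnalyticAt ℂ f (0, P)) : DifferentiableAt ℂ (fstDeriv f) P :=
  (DifferentiableAt.comp P hf.fderiv.differentiableAt (by fun_prop)).clm_comp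
    (differentiableAt_const _)

namespace PolarizedTangency

section Linear

variable {c : ℂ} {D D' : A → A →L[ℂ] A} {G : A → A}

/- The two points of the complexified hypersurface are sent to the complex line through `Z² ζ²`;
any pair of points `x`, `y` on it is reached, by rescaling `Z` and `ζ` by a fourth root of
`(x - y) / c`. -/
theorem eventually_sub_eq_on_line
    (h : PolarizedTangency c (fun p => D p.2 p.1) (fun p => D' p.2 p.1) G) (hc : c ≠ 0)
    (Z ζ : A) :
    ∀ᶠ v : ℂ × ℂ in 𝓝 0, G (v.1 • (Z ^ 2 * ζ ^ 2)) - G (v.2 • (Z ^ 2 * ζ ^ 2)) =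
      (2 * (v.1 - v.2)) • (D (v.1 • (Z ^ 2 * ζ ^ 2)) Z * (Z * ζ ^ 2) +
        D' (v.2 • (Z ^ 2 * ζ ^ 2)) ζ * (ζ * Z ^ 2)) := by
  let u : ℂ × ℂ → ℂ := fun v => ((v.1 - v.2) / c) ^ ((4 : ℕ) : ℂ)⁻¹
  have hu4 (v) : c * u v ^ 4 = v.1 - v.2 := by
    rw [Complex.cpow_nat_inv_pow _ four_ne_zero, mul_div_cancel₀ _ hc]
  have hu : Filter.Tendsto u (𝓝 0) (𝓝 0) := by
    have hroot := (Complex.continuousAt_cpow_const_of_re_pos (z := 0) (w := ((4 : ℕ) : ℂ)⁻¹)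
      (Or.inl le_rfl) (by norm_num)).tendsto
    rw [Complex.zero_cpow (by norm_num)] at hroot
    exact hroot.comp (Continuous.tendsto' (by fun_prop) 0 0 (by simp))
  have hpoint : Filter.Tendsto
      (fun v : ℂ × ℂ => (u v • Z, u v • ζ, v.1 • (Z ^ 2 * ζ ^ 2))) (𝓝 0) (𝓝 0) := by
    have hpoint' : Filter.Tendsto (fun w : ℂ × ℂ => (w.1 • Z, w.1 • ζ, w.2 • (Z ^ 2 * ζ ^ 2)))
      (𝓝 (0, 0)) (𝓝 0) := Continuous.tendsto' (by fun_prop) _ _ (by simp)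
    exact hpoint'.comp (hu.prodMk_nhds (continuous_fst.tendsto' 0 0 rfl))
  filter_upwards [hpoint.eventually h] with v hv
  have hV : c • ((u v • Z) ^ 2 * (u v • ζ) ^ 2) = (v.1 - v.2) • (Z ^ 2 * ζ ^ 2) := by
    rw [← hu4, smul_pow, smul_pow, smul_mul_smul_comm, smul_smul, ← pow_add]
  rw [hV, ← sub_smul, sub_sub_cancel] at hv
  rw [hv, ← hu4]
  simp only [map_smul, smul_pow, smul_mul_assoc, mul_smul_comm]
  module

theorem eventually_taylor_on_line
    (h : PolarizedTangency c (fun p => D p.2 p.1) (fun p => D' p.2 p.1) G) (hc : c ≠ 0)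
    (hD : DifferentiableAt ℂ D 0) (hG : DifferentiableAt ℂ G 0) (Z ζ : A) :
    ∀ᶠ x : ℂ in 𝓝 0,
      D (x • (Z ^ 2 * ζ ^ 2)) Z * (Z * ζ ^ 2) =
        (D 0 + x • fderiv ℂ D 0 (Z ^ 2 * ζ ^ 2)) Z * (Z * ζ ^ 2) ∧
      G (x • (Z ^ 2 * ζ ^ 2)) = G 0 + x • fderiv ℂ G 0 (Z ^ 2 * ζ ^ 2) +
        x ^ 2 • (2 : ℂ) • (fderiv ℂ D 0 (Z ^ 2 * ζ ^ 2) Z * (Z * ζ ^ 2)) := by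
  have hline : HasDerivAt (fun x : ℂ => x • (Z ^ 2 * ζ ^ 2)) (Z ^ 2 * ζ ^ 2) 0 := by
    simpa using (hasDerivAt_id (0 : ℂ)).smul_const (Z ^ 2 * ζ ^ 2)
  have hDline : HasDerivAt (fun x : ℂ => D (x • (Z ^ 2 * ζ ^ 2)))
      (fderiv ℂ D 0 (Z ^ 2 * ζ ^ 2)) 0 :=
    HasFDerivAt.comp_hasDerivAt_of_eq 0 hD.hasFDerivAt hline (zero_smul ℂ _).symm
  have hGline : HasDerivAt (fun x : ℂ => G (x • (Z ^ 2 * ζ ^ 2)))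
      (fderiv ℂ G 0 (Z ^ 2 * ζ ^ 2)) 0 :=
    HasFDerivAt.comp_hasDerivAt_of_eq 0 hG.hasFDerivAt hline (zero_smul ℂ _).symm
  have ha := (hDline.clm_apply (hasDerivAt_const 0 Z)).mul_const (Z * ζ ^ 2)
  filter_upwards [eventually_eq_taylor_of_sub_eq_smul_add ha hGline
    (b := fun y => D' (y • (Z ^ 2 * ζ ^ 2)) ζ * (ζ * Z ^ 2))
    (h.eventually_sub_eq_on_line hc Z ζ)] with x hx
  simpa [add_mul] using hx

end Linear

variable [CompleteSpace A] {c : ℂ} {f f' : A × A → A} {G : A → A}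

theorem eventually_fst_eq (h : PolarizedTangency c f f' G) (hc : c ≠ 0)
    (hf : AnalyticAt ℂ f 0) (hf' : ∀ᶠ p in 𝓝 0, DifferentiableAt ℂ f' p)
    (hG : DifferentiableAt ℂ G 0) :
    ∀ᶠ p in 𝓝 0, f p = fstDeriv f 0 p.1 + fderiv ℂ (fstDeriv f) 0 p.2 p.1 := by
  have hfd := hf.eventually_analyticAt.mono fun p hp => hp.differentiableAt
  suffices ∀ᶠ v : A × A in 𝓝 (1, 1), ∃ᶠ s : ℂ in 𝓝[≠] 0,
      f (s • v) - (fstDeriv f 0 (s • v).1 + fderiv ℂ (fstDeriv f) 0 (s • v).2 (s • v).1) = 0 from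
    (eventually_eq_zero_of_frequently_eq_zero_smul (H := fun p : A × A =>
      f p - (fstDeriv f 0 p.1 + fderiv ℂ (fstDeriv f) 0 p.2 p.1))
      (hfd.mono fun p hp => hp.sub (by fun_prop)) this).mono fun p hp => sub_eq_zero.1 hp
  filter_upwards [eventually_exists_units_sq_mul_sq_eq (A := A)]
  rintro ⟨Z, V⟩ ⟨hZ : IsUnit Z, ζ, hζ, hV : Z ^ 2 * ζ ^ 2 = V⟩
  have hsmul : Filter.Tendsto (fun s : ℂ => s • (Z, V)) (𝓝 0) (𝓝 0) :=
    Continuous.tendsto' (by fun_prop) 0 0 (zero_smul ℂ (Z, V))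
  refine Filter.Eventually.frequently ?_
  filter_upwards [(hsmul.eventually (h.eventually_mul_fst_eq hc hfd hf')).filter_mono
      nhdsWithin_le_nhds, ((h.linearize hc hfd hf').eventually_taylor_on_line hc
      (differentiableAt_fstDeriv hf) hG Z ζ).filter_mono nhdsWithin_le_nhds,
    self_mem_nhdsWithin] with s hs htaylor hs0
  have hlinear : fstDeriv f (s • V) Z = (fstDeriv f 0 + s • fderiv ℂ (fstDeriv f) 0 V) Z :=
    (hZ.mul (hζ.pow 2)).mul_left_inj.1 (hV ▸ htaylor.1)
  have hmul : f (s • (Z, V)) = fstDeriv f (s • V) (s • Z) :=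
    ((hZ.smul (Units.mk0 s hs0)).mul_left_inj).1 hs
  rw [hmul, map_smul, hlinear, sub_eq_zero]
  simp

theorem eventually_snd_eq (h : PolarizedTangency c f f' G) (hc : c ≠ 0)
    (hf : AnalyticAt ℂ f 0) (hf' : ∀ᶠ p in 𝓝 0, DifferentiableAt ℂ f' p)
    (hG : ∀ᶠ P in 𝓝 0, DifferentiableAt ℂ G P) :
    ∀ᶠ P in 𝓝 0, G P =
      G 0 + fderiv ℂ G 0 P + (2 : ℂ) • (fderiv ℂ (fstDeriv f) 0 P 1 * P) := by
  have hfd := hf.eventually_analyticAt.mono fun p hp => hp.differentiableAt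
  suffices ∀ᶠ V : A in 𝓝 1, ∃ᶠ s : ℂ in 𝓝[≠] 0, G (s • V) - (G 0 + fderiv ℂ G 0 (s • V) +
      (2 : ℂ) • (fderiv ℂ (fstDeriv f) 0 (s • V) 1 * (s • V))) = 0 from
    (eventually_eq_zero_of_frequently_eq_zero_smul (H := fun P : A => G P -
      (G 0 + fderiv ℂ G 0 P + (2 : ℂ) • (fderiv ℂ (fstDeriv f) 0 P 1 * P)))
      (hG.mono fun p hp => hp.sub (by fun_prop)) this).mono fun p hp => sub_eq_zero.1 hp
  filter_upwards [eventually_exists_sq_eq (A := A)]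
  rintro _ ⟨ζ, rfl⟩
  refine Filter.Eventually.frequently ?_
  filter_upwards [((h.linearize hc hfd hf').eventually_taylor_on_line hc
    (differentiableAt_fstDeriv hf) hG.self_of_nhds 1 ζ).filter_mono nhdsWithin_le_nhds]
    with s htaylor
  rw [one_pow, one_mul] at htaylor
  rw [htaylor.2, sub_eq_zero]
  simp only [map_smul, smul_apply, smul_mul_assoc, mul_smul_comm]
  module

end PolarizedTangency
end BanachAlgebra

namespace Cplx

section Algebraic

variable {S : Type*} [CommRing S]

theorem conj_ofReal (x : S) : conj (ofReal x) = ofReal x := by ext <;> simp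

theorem ofReal_re_eq_self {a : Cplx S} (h : a.im = 0) : ofReal a.re = a := by ext <;> simp [h]

theorem ofReal_injective : Function.Injective (ofReal : S → Cplx S) := fun _ _ h =>
  congrArg re h

variable [Algebra ℝ S]

instance : StarModule ℂ (Cplx S) where
  star_smul c a := by
    change conj (c • a) = conj c • conj a
    ext <;> simp [add_comm]

theorem conj_smul (c : ℂ) (a : Cplx S) : conj (c • a) = conj c • conj a := star_smul c a

theorem add_conj (a : Cplx S) : a + conj a = (2 : ℂ) • ofReal a.re := by
  ext <;> simp [two_smul]

theorem sub_conj (a : Cplx S) : a - conj a = (2 * Complex.I) • ofReal a.im := by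
  ext <;> simp [two_smul]

end Algebraic

section Analytic

variable {S : Type*} [CommRing S] [Algebra ℝ S] [FiniteDimensional ℝ S]

instance : CompleteSpace (Cplx S) := FiniteDimensional.complete ℂ (Cplx S)

instance : FiniteDimensional ℝ (Cplx S) := FiniteDimensional.complexToReal (Cplx S)

instance : ContinuousStar (Cplx S) where
  continuous_star := (starLinearEquiv ℝ (A := Cplx S)).toLinearMap.continuous_of_finiteDimensional

end Analytic
end Cplx

open Cplx

section Tangent

variable {S : Type*} [CommRing S] [Algebra ℝ S]

theorem quarticFun_eq_smul_sub_conj (p : Cplx S × Cplx S) :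
    quarticFun S p = (2 * Complex.I)⁻¹ • (p.2 - conj p.2) - p.1 ^ 2 * conj p.1 ^ 2 := by
  rw [quarticFun_eq, quarticForm, Cplx.sub_conj, inv_smul_smul₀ (by simp)]

theorem mem_quartic_iff_sub_conj {p : Cplx S × Cplx S} :
    p ∈ quartic S ↔ p.2 - conj p.2 = (2 * Complex.I) • (p.1 ^ 2 * conj p.1 ^ 2) := by
  change quarticFun S p = 0 ↔ _
  rw [quarticFun_eq_smul_sub_conj, sub_eq_zero, inv_smul_eq_iff₀ (by simp)]

variable [FiniteDimensional ℝ S]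

theorem fderiv_quarticFun_apply (p v : Cplx S × Cplx S) :
    fderiv ℝ (quarticFun S) p v = (2 * Complex.I)⁻¹ • (v.2 - conj v.2) -
      (2 : ℂ) • (v.1 * p.1 * conj p.1 ^ 2 + conj (v.1 * p.1 * conj p.1 ^ 2)) := by
  have hfst : HasFDerivAt (fun q : Cplx S × Cplx S => q.1)
    (ContinuousLinearMap.fst ℝ (Cplx S) (Cplx S)) p := hasFDerivAt_fst
  have hsnd : HasFDerivAt (fun q : Cplx S × Cplx S => q.2)
    (ContinuousLinearMap.snd ℝ (Cplx S) (Cplx S)) p := hasFDerivAt_snd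
  have hderiv := ((hsnd.sub hsnd.star).const_smul (2 * Complex.I)⁻¹).sub
    ((hfst.pow 2).mul (hfst.star.pow 2))
  rw [(hderiv.congr_of_eventuallyEq
    (Filter.Eventually.of_forall quarticFun_eq_smul_sub_conj)).fderiv]
  simp only [Nat.add_one_sub_one, pow_one, nsmul_eq_mul, Nat.cast_ofNat, sub_apply, add_apply,
    smul_apply, ContinuousLinearMap.coe_fst', ContinuousLinearMap.coe_snd',
    ContinuousLinearMap.comp_apply, ContinuousLinearEquiv.coe_coe, starL'_apply, smul_eq_mul,
    starRingEnd_apply, star_mul', star_pow, star_star, two_smul ℂ]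
  ring

theorem mem_tangentAt_quarticFun_iff {p v : Cplx S × Cplx S} :
    v ∈ tangentAt (quarticFun S) p ↔ v.2 - conj v.2 =
      (4 * Complex.I) • (v.1 * p.1 * conj p.1 ^ 2 + conj (v.1 * p.1 * conj p.1 ^ 2)) := by
  rw [tangentAt, LinearMap.mem_ker, ContinuousLinearMap.coe_coe, fderiv_quarticFun_apply,
    sub_eq_zero, inv_smul_eq_iff₀ (by simp), smul_smul, mul_right_comm]
  norm_num

theorem mem_complexTangentAt_quarticFun_iff {p v : Cplx S × Cplx S} :
    v ∈ complexTangentAt (quarticFun S) p ↔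
      v.2 = (4 * Complex.I) • (v.1 * p.1 * conj p.1 ^ 2) := by
  simp only [complexTangentAt, Set.mem_ofPred_eq, mem_tangentAt_quarticFun_iff, Prod.smul_fst,
    Prod.smul_snd, smul_mul_assoc, conj_smul, Complex.conj_I]
  generalize v.1 * p.1 * conj p.1 ^ 2 = X
  constructor
  · rintro ⟨h, hI⟩
    refine smul_right_injective _ (two_ne_zero (α := ℂ)) ?_
    linear_combination (norm := (match_scalars <;> ring_nf <;> norm_num [Complex.I_pow_three]))
      h - Complex.I • hI
  · intro h
    rw [h, conj_smul, map_mul, Complex.conj_I, Complex.conj_ofNat]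
    constructor <;> module

end Tangent

section Nondegenerate

theorem smul_eq_iterated_difference_pow_four {S : Type*} [CommRing S] [Algebra ℝ S] (y : S) :
    (48 : ℝ) • y = (8 : ℝ) • ((1 + y) ^ 4 - (1 - y) ^ 4) -
      ((1 + (2 : ℝ) • y) ^ 4 - (1 - (2 : ℝ) • y) ^ 4) := by
  simp only [Algebra.smul_def, map_ofNat]
  ring

theorem span_range_pow_four_eq_top (S : Type*) [CommRing S] [Algebra ℝ S] :
    Submodule.span ℝ (Set.range fun x : S => x ^ 4) = ⊤ := by
  refine Submodule.eq_top_iff'.2 fun y => ?_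
  have hpow (x : S) : x ^ 4 ∈ Submodule.span ℝ (Set.range fun x : S => x ^ 4) :=
    Submodule.subset_span ⟨x, rfl⟩
  rw [← Submodule.smul_mem_iff _ (show (48 : ℝ) ≠ 0 by norm_num),
    smul_eq_iterated_difference_pow_four]
  exact sub_mem (Submodule.smul_mem _ _ (sub_mem (hpow _) (hpow _))) (sub_mem (hpow _) (hpow _))

theorem coordinatesIndependent_of_span_range_eq_top {V S : Type*} [AddCommGroup S] [Module ℝ S]
    {φ : V → S} (hφ : Submodule.span ℝ (Set.range φ) = ⊤) : CoordinatesIndependent φ := by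
  refine fun b => Fintype.linearIndependent_iff.2 fun g hg i => ?_
  have hl : ∑ j, g j • b.coord j = 0 :=
    LinearMap.ext_on_range hφ fun Z => by simpa using congrFun hg Z
  simpa [Finsupp.single_apply] using LinearMap.congr_fun hl (b i)

theorem coordinatesIndependent_quarticForm (S : Type*) [CommRing S] [Algebra ℝ S] :
    CoordinatesIndependent (fun Z : Cplx S => (quarticForm S Z (conj Z)).re) := by
  refine coordinatesIndependent_of_span_range_eq_top (top_le_iff.1 ?_)
  rw [← span_range_pow_four_eq_top S]
  refine Submodule.span_mono (Set.range_subset_iff.2 fun x => ⟨ofReal x, ?_⟩)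
  simp [quarticForm, pow_succ, mul_assoc]

theorem fullDimension_quarticForm (S : Type*) [CommRing S] [Algebra ℝ S]
    [FiniteDimensional ℝ S] : FullDimension (quarticForm S) := by
  refine ⟨1, mem_interior_iff_mem_nhds.2 (eventually_exists_sq_eq.mono ?_)⟩
  rintro _ ⟨Z, rfl⟩
  exact ⟨(Z, 1), by simp [quarticForm]⟩

end Nondegenerate

section FiniteType

theorem lieBracket_prodMk_comp_fst {A B : Type*} [NormedAddCommGroup A] [NormedSpace ℝ A]
    [NormedAddCommGroup B] [NormedSpace ℝ B] (c d : A) {k m : A → B}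
    (hk : Differentiable ℝ k) (hm : Differentiable ℝ m) :
    VectorField.lieBracket ℝ (fun p : A × B => (c, k p.1)) (fun p => (d, m p.1)) =
      fun p => (0, fderiv ℝ m p.1 c - fderiv ℝ k p.1 d) := by
  have hfderiv (d : A) {m : A → B} (hm : Differentiable ℝ m) (p v : A × B) :
      fderiv ℝ (fun p : A × B => (d, m p.1)) p v = (0, fderiv ℝ m p.1 v.1) := by
    have hcomp : HasFDerivAt (fun p : A × B => m p.1) _ p :=
      (hm p.1).hasFDerivAt.comp p hasFDerivAt_fst
    rw [((hasFDerivAt_const d p).prodMk hcomp).fderiv]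
    rfl
  ext1 p
  rw [VectorField.lieBracket, hfderiv d hm, hfderiv c hk]
  exact Prod.ext (sub_zero 0) rfl

variable {S : Type*} [CommRing S] [Algebra ℝ S] [FiniteDimensional ℝ S]

/-- The second component of the section of the complex tangent bundle of the quartic with
constant first component `c`. -/
def sectionSnd (c Z : Cplx S) : Cplx S := (4 * Complex.I) • (c * Z * conj Z ^ 2)

theorem contDiff_sectionSnd (c : Cplx S) : ContDiff ℝ ∞ (sectionSnd c) :=
  ((contDiff_const.mul contDiff_id).mul ((starL' ℝ).contDiff.pow 2)).const_smul (4 * Complex.I)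

theorem differentiable_sectionSnd (c : Cplx S) : Differentiable ℝ (sectionSnd c) :=
  (contDiff_sectionSnd c).differentiable (by simp)

theorem fderiv_sectionSnd_apply (c Z v : Cplx S) : fderiv ℝ (sectionSnd c) Z v =
    (4 * Complex.I) • (c * (v * conj Z ^ 2 + 2 * (Z * conj Z * conj v))) := by
  have hid : HasFDerivAt (fun Z : Cplx S => Z) (ContinuousLinearMap.id ℝ (Cplx S)) Z :=
    hasFDerivAt_id Z
  have hderiv : HasFDerivAt (sectionSnd c) _ Z :=
    ((hid.const_mul c).mul (hid.star.pow 2)).const_smul (4 * Complex.I)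
  rw [hderiv.fderiv]
  simp only [Nat.add_one_sub_one, pow_one, nsmul_eq_mul, Nat.cast_ofNat, smul_eq_mul,
    ContinuousLinearMap.comp_id, add_apply, smul_apply, ContinuousLinearEquiv.coe_coe,
    starL'_apply, ContinuousLinearMap.id_apply, starRingEnd_apply]
  congr 1
  ring

theorem isIteratedBracket_section (c : Cplx S) :
    IsIteratedBracket (quarticFun S) (fun p => (c, sectionSnd c p.1)) :=
  .of_section _ (contDiff_const.prodMk ((contDiff_sectionSnd c).comp contDiff_fst))
    fun _ _ => mem_complexTangentAt_quarticFun_iff.2 rfl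

theorem isIteratedBracket_fderiv {m : Cplx S → Cplx S} (hm : Differentiable ℝ m) (c : Cplx S)
    (h : IsIteratedBracket (quarticFun S) fun p => (0, m p.1)) :
    IsIteratedBracket (quarticFun S) fun p => (0, fderiv ℝ m p.1 c) := by
  have hbracket := (isIteratedBracket_section c).bracket _ _ h
  rw [lieBracket_prodMk_comp_fst _ _ (differentiable_sectionSnd c) hm] at hbracket
  simpa using hbracket

theorem isIteratedBracket_mul_conj {c : Cplx S} (hc : conj c = c) :
    IsIteratedBracket (quarticFun S) fun p => (0, (16 : ℂ) • (c * (p.1 * conj p.1))) := by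
  have hbracket := (isIteratedBracket_section (Complex.I • c)).bracket _ _
    (isIteratedBracket_section 1)
  rw [lieBracket_prodMk_comp_fst _ _ (differentiable_sectionSnd _)
    (differentiable_sectionSnd _)] at hbracket
  convert hbracket using 3 with p
  simp only [fderiv_sectionSnd_apply, conj_smul, Complex.conj_I, hc, map_one]
  simp only [Algebra.smul_def, map_mul, map_neg, map_ofNat]
  have hI : algebraMap ℂ (Cplx S) Complex.I * algebraMap ℂ (Cplx S) Complex.I = -1 := by
    rw [← map_mul, Complex.I_mul_I, map_neg, map_one]
  linear_combination 16 * c * (p.1 * conj p.1) * hI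

theorem isIteratedBracket_const {c : Cplx S} (hc : conj c = c) :
    IsIteratedBracket (quarticFun S) fun _ => (0, (32 : ℂ) • c) := by
  have hid (Z : Cplx S) : HasFDerivAt (fun Z : Cplx S => Z) (ContinuousLinearMap.id ℝ (Cplx S)) Z :=
    hasFDerivAt_id Z
  have hmul (Z : Cplx S) : HasFDerivAt (fun Z => (16 : ℂ) • (c * (Z * conj Z))) _ Z :=
    (((hid Z).mul (hid Z).star).const_mul c).const_smul (16 : ℂ)
  have hadd (Z : Cplx S) : HasFDerivAt (fun Z => (16 : ℂ) • (c * (Z + conj Z))) _ Z :=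
    (((hid Z).add (hid Z).star).const_mul c).const_smul (16 : ℂ)
  have hbracket := isIteratedBracket_fderiv (fun Z => (hmul Z).differentiableAt) 1
    (isIteratedBracket_mul_conj hc)
  have hfderiv (Z : Cplx S) : fderiv ℝ (fun Z => (16 : ℂ) • (c * (Z * conj Z))) Z 1 =
      (16 : ℂ) • (c * (Z + conj Z)) := by
    rw [(hmul Z).fderiv]
    simp [starRingEnd_apply, mul_add]
  simp only [hfderiv] at hbracket
  convert isIteratedBracket_fderiv (fun Z => (hadd Z).differentiableAt) 1 hbracket using 3 with p
  rw [(hadd p.1).fderiv]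
  simp only [ContinuousLinearMap.comp_id, smul_add, add_apply, smul_apply,
    ContinuousLinearMap.id_apply, smul_eq_mul, mul_one, ContinuousLinearEquiv.coe_coe, starL'_apply,
    star_one]
  module

theorem finiteTypeAt_quarticFun (p : Cplx S × Cplx S) : FiniteTypeAt (quarticFun S) p := by
  intro v hv
  have hreal : conj (v.2 - sectionSnd v.1 p.1) = v.2 - sectionSnd v.1 p.1 := by
    rw [mem_tangentAt_quarticFun_iff] at hv
    simp only [sectionSnd, map_sub, conj_smul, map_mul, Complex.conj_I, Complex.conj_ofNat] at hv ⊢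
    linear_combination (norm := module) -hv
  have hv : v = (v.1, sectionSnd v.1 p.1) +
      (32⁻¹ : ℝ) • (0, (32 : ℂ) • (v.2 - sectionSnd v.1 p.1)) := by
    have hscale (a : Cplx S) : (32⁻¹ : ℝ) • (32 : ℂ) • a = a := by
      rw [RCLike.real_smul_eq_coe_smul (K := ℂ), smul_smul]
      norm_num
    rw [Prod.smul_mk, hscale, smul_zero, Prod.mk_add_mk, add_zero, add_sub_cancel]
  rw [hv]
  exact add_mem (Submodule.subset_span ⟨_, isIteratedBracket_section v.1, rfl⟩)
    (Submodule.smul_mem _ _ (Submodule.subset_span ⟨_, isIteratedBracket_const hreal, rfl⟩))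

end FiniteType

section Uniqueness

variable {S : Type*} [CommRing S] [Algebra ℝ S]

theorem mk_add_smul_mem_quartic {Z U : Cplx S} (hU : conj U = U) :
    (Z, U + Complex.I • (Z ^ 2 * conj Z ^ 2)) ∈ quartic S := by
  rw [mem_quartic_iff_sub_conj]
  simp only [map_add, conj_smul, map_mul, map_pow, Complex.conj_conj, Complex.conj_I, hU]
  rw [mul_comm (conj Z ^ 2)]
  module

theorem conj_sub_smul_of_mem_quartic {p : Cplx S × Cplx S} (hp : p ∈ quartic S) :
    conj (p.2 - Complex.I • (p.1 ^ 2 * conj p.1 ^ 2)) =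
      p.2 - Complex.I • (p.1 ^ 2 * conj p.1 ^ 2) := by
  rw [mem_quartic_iff_sub_conj] at hp
  simp only [map_sub, conj_smul, map_mul, map_pow, starRingEnd_self_apply, Complex.conj_I]
  rw [mul_comm (conj p.1 ^ 2)]
  linear_combination (norm := module) -hp

variable [FiniteDimensional ℝ S]

/-- The antiholomorphic involution `(Z, ζ, U) ↦ (conj ζ, conj Z, conj U)`. Its fixed points
`(Z, conj Z, U)` with `U` real parametrize the quartic. -/
def polarConj (S : Type*) [CommRing S] [Algebra ℝ S] [FiniteDimensional ℝ S] :
    (Cplx S × Cplx S × Cplx S) →L[ℝ] Cplx S × Cplx S × Cplx S :=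
  ((starL' ℝ : Cplx S ≃L[ℝ] Cplx S) : Cplx S →L[ℝ] Cplx S).prodMap
    (((starL' ℝ : Cplx S ≃L[ℝ] Cplx S) : Cplx S →L[ℝ] Cplx S).prodMap
      ((starL' ℝ : Cplx S ≃L[ℝ] Cplx S) : Cplx S →L[ℝ] Cplx S)) ∘L
  (((ContinuousLinearMap.fst ℝ _ _).comp (ContinuousLinearMap.snd ℝ _ _)).prod
    ((ContinuousLinearMap.fst ℝ _ _).prod
      ((ContinuousLinearMap.snd ℝ _ _).comp (ContinuousLinearMap.snd ℝ _ _))))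

theorem polarConj_apply (u : Cplx S × Cplx S × Cplx S) :
    polarConj S u = (conj u.2.1, conj u.1, conj u.2.2) := rfl

theorem eventually_eq_zero_of_eventually_mem_quartic {E : Type*} [NormedAddCommGroup E]
    [NormedSpace ℂ E] [CompleteSpace E] {p₀ : Cplx S × Cplx S} (hp₀ : p₀ ∈ quartic S)
    {H : Cplx S × Cplx S × Cplx S → E}
    (hH : ∀ᶠ v in 𝓝 (p₀.1, conj p₀.1, p₀.2), DifferentiableAt ℂ H v)
    (h : ∀ᶠ p in 𝓝 p₀, p ∈ quartic S → H (p.1, conj p.1, p.2) = 0) :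
    ∀ᶠ v in 𝓝 (p₀.1, conj p₀.1, p₀.2), H v = 0 := by
  obtain ⟨Z₀, W₀⟩ := p₀
  have hU₀ := conj_sub_smul_of_mem_quartic hp₀
  dsimp only at hH hU₀ ⊢
  have hparam : Filter.Tendsto (fun u : Cplx S × Cplx S × Cplx S =>
      (u.1, u.2.1, u.2.2 + Complex.I • (u.1 ^ 2 * u.2.1 ^ 2)))
      (𝓝 (Z₀, conj Z₀, W₀ - Complex.I • (Z₀ ^ 2 * conj Z₀ ^ 2))) (𝓝 (Z₀, conj Z₀, W₀)) :=
    Continuous.tendsto' (by fun_prop) _ _ (by simp only [sub_add_cancel])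
  have hinv : Filter.Tendsto (fun v : Cplx S × Cplx S × Cplx S =>
      (v.1, v.2.1, v.2.2 - Complex.I • (v.1 ^ 2 * v.2.1 ^ 2)))
      (𝓝 (Z₀, conj Z₀, W₀)) (𝓝 (Z₀, conj Z₀, W₀ - Complex.I • (Z₀ ^ 2 * conj Z₀ ^ 2))) :=
    Continuous.tendsto' (by fun_prop) _ _ rfl
  have hproj : Filter.Tendsto (fun v : Cplx S × Cplx S × Cplx S => (v.1, v.2.2))
      (𝓝 (Z₀, conj Z₀, W₀)) (𝓝 (Z₀, W₀)) :=
    Continuous.tendsto' (by fun_prop) _ _ rfl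
  suffices hzero : ∀ᶠ u : Cplx S × Cplx S × Cplx S in
      𝓝 (Z₀, conj Z₀, W₀ - Complex.I • (Z₀ ^ 2 * conj Z₀ ^ 2)),
      H (u.1, u.2.1, u.2.2 + Complex.I • (u.1 ^ 2 * u.2.1 ^ 2)) = 0 by
    filter_upwards [hinv.eventually hzero] with v hv
    simpa only [sub_add_cancel] using hv
  refine eventually_eq_zero_of_eventually_eq_zero_on_fixedPoints (σ := polarConj S)
    (fun v => ?_) (fun v => ?_) ?_ ?_ ?_
  · simp only [polarConj_apply, Prod.smul_fst, Prod.smul_snd, conj_smul, Complex.conj_I, neg_smul]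
    rfl
  · simp only [polarConj_apply, starRingEnd_self_apply]
  · simp only [polarConj_apply, starRingEnd_self_apply, hU₀]
  · filter_upwards [hparam.eventually hH] with u hu
    exact hu.comp u (by fun_prop)
  · filter_upwards [hparam.eventually (hproj.eventually h)] with u hu hfix
    obtain ⟨Z, ζ, U⟩ := u
    simp only [polarConj_apply, Prod.mk.injEq] at hfix
    obtain ⟨-, rfl, hU⟩ := hfix
    exact hu (mk_add_smul_mem_quartic hU)

end Uniqueness

section HolNondegenerate

theorem eventually_isUnit_add_smul {A : Type*} [CommRing A] [Algebra ℂ A] [FiniteDimensional ℂ A]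
    (z : A) : ∀ᶠ t : ℂ in 𝓝[≠] 0, IsUnit (z + t • (1 : A)) := by
  have hfinite : (spectrum ℂ (-z)).Finite := by
    refine (Module.End.finite_spectrum (Algebra.lmul ℂ A (-z))).subset fun t ht => ?_
    rw [spectrum.mem_iff] at ht ⊢
    refine fun hu => ht ?_
    rw [← AlgHom.commutes (Algebra.lmul ℂ A), ← map_sub] at hu
    obtain ⟨y, hy⟩ := ((Module.End.isUnit_iff _).1 hu).2 1
    exact IsUnit.of_mul_eq_one y hy
  filter_upwards [hfinite.eventually_cofinite_notMem.filter_mono (nhdsNE_le_cofinite 0)]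
    with t ht
  rwa [spectrum.notMem_iff, sub_neg_eq_add, Algebra.algebraMap_eq_smul_one, add_comm] at ht

theorem eventually_eq_zero_of_eventually_mul_fst_eq_zero {A E : Type*} [NormedCommRing A]
    [NormedAlgebra ℂ A] [FiniteDimensional ℂ A] [TopologicalSpace E] {f : A × E → A} {p : A × E}
    (hf : ∀ᶠ q in 𝓝 p, ContinuousAt f q) (h : ∀ᶠ q in 𝓝 p, f q * q.1 = 0) :
    ∀ᶠ q in 𝓝 p, f q = 0 := by
  filter_upwards [h.eventually_nhds, hf] with q hq hfq
  have hline : Filter.Tendsto (fun t : ℂ => (q.1 + t • (1 : A), q.2)) (𝓝[≠] 0) (𝓝 q) :=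
    (Continuous.tendsto' (by fun_prop) 0 q (by simp)).mono_left nhdsWithin_le_nhds
  refine tendsto_nhds_unique ((hfq.tendsto.comp hline).congr' ?_) tendsto_const_nhds
  filter_upwards [hline.eventually hq, eventually_isUnit_add_smul q.1] with t ht hunit
  exact hunit.mul_left_eq_zero.1 ht

theorem eq_zero_of_eventually_sub_mul_sq_eq_zero {A : Type*} [NormedCommRing A] [NormedAlgebra ℂ A]
    {a b ζ₀ : A} (h : ∀ᶠ ζ in 𝓝 ζ₀, b - a * ζ ^ 2 = 0) : a = 0 ∧ b = 0 := by
  have hplus : Filter.Tendsto (fun t : ℂ => ζ₀ + t • (1 : A)) (𝓝[≠] 0) (𝓝 ζ₀) :=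
    (Continuous.tendsto' (by fun_prop) 0 ζ₀ (by simp)).mono_left nhdsWithin_le_nhds
  have hminus : Filter.Tendsto (fun t : ℂ => ζ₀ - t • (1 : A)) (𝓝[≠] 0) (𝓝 ζ₀) :=
    (Continuous.tendsto' (by fun_prop) 0 ζ₀ (by simp)).mono_left nhdsWithin_le_nhds
  have h₀ := h.self_of_nhds
  obtain ⟨t, ⟨ht₁, ht₂⟩, ht⟩ :=
    (((hplus.eventually h).and (hminus.eventually h)).and self_mem_nhdsWithin).exists
  have hsecond : (2 * t ^ 2) • a = 0 := by
    simp only [Algebra.smul_def, map_mul, map_pow, map_ofNat] at ht₁ ht₂ ⊢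
    linear_combination 2 * h₀ - ht₁ - ht₂
  have ha : a = 0 := (smul_eq_zero.1 hsecond).resolve_left (by simpa using ht)
  exact ⟨ha, by simpa [ha] using h₀⟩

variable {S : Type*} [CommRing S] [Algebra ℝ S] [FiniteDimensional ℝ S]

theorem holNondegenerateAt_quarticFun {p : Cplx S × Cplx S} (hp : p ∈ quartic S) :
    HolNondegenerateAt (quarticFun S) p := by
  intro X hX htangent
  have hproj : Filter.Tendsto (fun v : Cplx S × Cplx S × Cplx S => (v.1, v.2.2))
      (𝓝 (p.1, conj p.1, p.2)) (𝓝 p) := Continuous.tendsto' (by fun_prop) _ _ rfl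
  have hpolarized : ∀ᶠ v : Cplx S × Cplx S × Cplx S in 𝓝 (p.1, conj p.1, p.2),
      (X (v.1, v.2.2)).2 - (4 * Complex.I) • ((X (v.1, v.2.2)).1 * v.1) * v.2.1 ^ 2 = 0 := by
    refine eventually_eq_zero_of_eventually_mem_quartic hp ?_ ?_
    · filter_upwards [hproj.eventually hX.eventually_analyticAt] with v hv
      have hXv : DifferentiableAt ℂ (fun v : Cplx S × Cplx S × Cplx S => X (v.1, v.2.2)) v :=
        hv.differentiableAt.comp v (by fun_prop)
      exact hXv.snd.fun_sub (((hXv.fst.fun_mul (by fun_prop)).fun_const_smul _).fun_mul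
        (by fun_prop))
    · filter_upwards [htangent] with q hq hmem
      rw [smul_mul_assoc, sub_eq_zero]
      exact mem_complexTangentAt_quarticFun_iff.1 (hq hmem)
  have hswap : Filter.Tendsto (fun v : (Cplx S × Cplx S) × Cplx S => (v.1.1, v.2, v.1.2))
      (𝓝 (p, conj p.1)) (𝓝 (p.1, conj p.1, p.2)) := Continuous.tendsto' (by fun_prop) _ _ rfl
  have hcoeff : ∀ᶠ q in 𝓝 p, (X q).1 * q.1 = 0 ∧ (X q).2 = 0 := by
    filter_upwards [(hswap.eventually hpolarized).curry_nhds] with q hq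
    obtain ⟨hfst, hsnd⟩ := eq_zero_of_eventually_sub_mul_sq_eq_zero hq
    exact ⟨(smul_eq_zero.1 hfst).resolve_left (by simp), hsnd⟩
  have hfst : ∀ᶠ q in 𝓝 p, (X q).1 = 0 :=
    eventually_eq_zero_of_eventually_mul_fst_eq_zero
      (hX.eventually_analyticAt.mono fun q hq => hq.continuousAt.fst) (hcoeff.mono fun q hq => hq.1)
  filter_upwards [hfst, hcoeff] with q hq₁ hq
  exact Prod.ext hq₁ hq.2

end HolNondegenerate

section Relations

theorem eq_zero_of_infinite_sum_pow_smul_eq_zero {K M ι : Type*} [Field K] [AddCommGroup M]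
    [Module K M] [Fintype ι] {e : ι → ℕ} (he : Function.Injective e) {a : ι → M}
    (h : {s : K | ∑ i, s ^ e i • a i = 0}.Infinite) (j : ι) : a j = 0 := by
  classical
  refine (Module.forall_dual_apply_eq_zero_iff K (a j)).1 fun φ => ?_
  have hpoly : ∑ i, Polynomial.monomial (e i) (φ (a i)) = 0 :=
    Polynomial.eq_zero_of_infinite_isRoot _ (h.mono fun s hs => by
      simpa [Polynomial.eval_finsetSum, mul_comm] using congrArg φ hs)
  simpa [Polynomial.finsetSum_coeff, Polynomial.coeff_monomial, he.eq_iff] using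
    congrArg (Polynomial.coeff · (e j)) hpoly

variable {S : Type*} [CommRing S]

theorem ofReal_re_sq_mul_conj_sq (Z : Cplx S) :
    ofReal (Z ^ 2 * conj Z ^ 2).re = Z ^ 2 * conj Z ^ 2 :=
  ofReal_re_eq_self (quarticForm_conj_im Z)

variable [Algebra ℝ S]

/-- The vector field `(L Z + B(W, Z)) ∂/∂Z + (q + R W + r(W, W)) ∂/∂W`. -/
def quadraticField (L : Cplx S →ₗ[ℂ] Cplx S) (B : Cplx S →ₗ[ℂ] Cplx S →ₗ[ℂ] Cplx S)
    (q : Cplx S) (R : Cplx S →ₗ[ℂ] Cplx S) (r : Cplx S →ₗ[ℂ] Cplx S →ₗ[ℂ] Cplx S)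
    (p : Cplx S × Cplx S) : Cplx S × Cplx S :=
  (L p.1 + B p.2 p.1, q + R p.2 + r p.2 p.2)

/-- The relations between the coefficients of `quadraticField L B q R r` which express, for
symmetric `r`, that this field is tangent to the quartic. -/
structure QuadraticRelations (L : Cplx S →ₗ[ℂ] Cplx S) (B : Cplx S →ₗ[ℂ] Cplx S →ₗ[ℂ] Cplx S)
    (q : Cplx S) (R : Cplx S →ₗ[ℂ] Cplx S) (r : Cplx S →ₗ[ℂ] Cplx S →ₗ[ℂ] Cplx S) : Prop where
  const_im : q.im = 0
  linear_im (U : S) : (R (ofReal U)).im = 0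
  quadratic_im (U : S) : (r (ofReal U) (ofReal U)).im = 0
  linear_eq (Z : Cplx S) : ofReal (4 * (L Z * Z * conj Z ^ 2).re) = R (Z ^ 2 * conj Z ^ 2)
  bilinear_eq (U : S) (Z : Cplx S) :
    ofReal (2 * (B (ofReal U) Z * Z * conj Z ^ 2).re) = r (ofReal U) (Z ^ 2 * conj Z ^ 2)
  bilinear_im (Z : Cplx S) : (B (Z ^ 2 * conj Z ^ 2) Z * Z * conj Z ^ 2).im = 0

variable {L : Cplx S →ₗ[ℂ] Cplx S} {B : Cplx S →ₗ[ℂ] Cplx S →ₗ[ℂ] Cplx S} {q : Cplx S}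
  {R : Cplx S →ₗ[ℂ] Cplx S} {r : Cplx S →ₗ[ℂ] Cplx S →ₗ[ℂ] Cplx S}

theorem quadraticField_add_smul (hr : ∀ W W', r W W' = r W' W) (Z U V : Cplx S) :
    quadraticField L B q R r (Z, U + Complex.I • V) =
      (L Z + B U Z + Complex.I • B V Z,
        q + R U + r U U - r V V + Complex.I • (R V + (2 : ℂ) • r U V)) := by
  simp only [quadraticField, map_add, map_smul, LinearMap.add_apply, LinearMap.smul_apply, hr V U,
    smul_add, smul_smul, Complex.I_mul_I, Prod.mk.injEq]
  constructor <;> module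

theorem quadraticRelations_of_forall (hr : ∀ W W', r W W' = r W' W)
    (h : ∀ (U : S) (Z V : Cplx S), V = Z ^ 2 * conj Z ^ 2 →
      q.im = 0 ∧ (R (ofReal U)).im = 0 ∧ (r (ofReal U) (ofReal U)).im = 0 ∧
        (R V).re = 4 * (L Z * Z * conj Z ^ 2).re ∧
        2 * (r (ofReal U) V).re = 4 * (B (ofReal U) Z * Z * conj Z ^ 2).re ∧
        4 * (B V Z * Z * conj Z ^ 2).im = (r V V).im) :
    QuadraticRelations L B q R r := by
  have hRreal (U : S) : (R (ofReal U)).im = 0 := (h U 0 _ rfl).2.1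
  have hrdiag (U : S) : (r (ofReal U) (ofReal U)).im = 0 := (h U 0 _ rfl).2.2.1
  have hrreal (U V : S) : (r (ofReal U) (ofReal V)).im = 0 := by
    have hsum := hrdiag (U + V)
    rw [show ofReal (U + V) = ofReal U + ofReal V by ext <;> simp] at hsum
    simp only [map_add, LinearMap.add_apply, add_im, hrdiag, hr (ofReal V), zero_add, add_zero,
      ← two_smul ℝ] at hsum
    exact (smul_eq_zero.1 hsum).resolve_left two_ne_zero
  refine ⟨(h 0 0 _ rfl).1, hRreal, hrdiag, fun Z => ?_, fun U Z => ?_, fun Z => ?_⟩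
  · rw [← (h 0 Z _ rfl).2.2.2.1]
    apply ofReal_re_eq_self
    rw [← ofReal_re_sq_mul_conj_sq, hRreal]
  · have hhalf : (r (ofReal U) (Z ^ 2 * conj Z ^ 2)).re =
        2 * (B (ofReal U) Z * Z * conj Z ^ 2).re := by
      refine smul_right_injective S (two_ne_zero (α := ℝ)) ?_
      simp only [Algebra.smul_def, map_ofNat]
      linear_combination (h U Z _ rfl).2.2.2.2.1
    rw [← hhalf]
    apply ofReal_re_eq_self
    rw [← ofReal_re_sq_mul_conj_sq, hrreal]
  · have hzero := (h 0 Z _ rfl).2.2.2.2.2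
    have hV := hrdiag (Z ^ 2 * conj Z ^ 2).re
    rw [ofReal_re_sq_mul_conj_sq] at hV
    refine smul_right_injective S (four_ne_zero (α := ℝ)) ?_
    simp only [Algebra.smul_def, map_ofNat, mul_zero, hzero, hV]

variable [FiniteDimensional ℝ S]

theorem mem_tangentAt_quarticFun_iff_im {p v : Cplx S × Cplx S} :
    v ∈ tangentAt (quarticFun S) p ↔ v.2.im = 4 * (v.1 * p.1 * conj p.1 ^ 2).re := by
  have hofReal (x : S) : ofReal (4 * x) = (4 : ℂ) • ofReal x := by
    ext <;> simp only [smul_re, smul_im, ofReal_re, ofReal_im, Complex.re_ofNat, Complex.im_ofNat,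
      zero_smul, smul_zero, sub_zero, add_zero]
    rw [Algebra.smul_def, map_ofNat]
  rw [mem_tangentAt_quarticFun_iff, sub_conj, add_conj, smul_smul,
    show 4 * Complex.I * 2 = 2 * Complex.I * 4 by ring, mul_smul _ 4,
    (smul_right_injective (Cplx S) (show 2 * Complex.I ≠ 0 by simp)).eq_iff,
    ← (ofReal_injective (S := S)).eq_iff, hofReal]

theorem quadraticField_mem_tangentAt_iff (hr : ∀ W W', r W W' = r W' W) {Z U V W : Cplx S} :
    quadraticField L B q R r (Z, U + Complex.I • V) ∈ tangentAt (quarticFun S) (Z, W) ↔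
      q.im + (R U).im + (r U U).im + ((R V).re - 4 * (L Z * Z * conj Z ^ 2).re) +
        (2 * (r U V).re - 4 * (B U Z * Z * conj Z ^ 2).re) +
        (4 * (B V Z * Z * conj Z ^ 2).im - (r V V).im) = 0 := by
  rw [mem_tangentAt_quarticFun_iff_im, quadraticField_add_smul hr, ← sub_eq_zero]
  simp only [add_mul, smul_mul_assoc, add_re, add_im, sub_im, smul_re, smul_im, Complex.I_re,
    Complex.I_im, zero_smul, one_smul, zero_sub, zero_add, two_smul]
  refine Eq.congr ?_ rfl
  ring

theorem QuadraticRelations.mem_tangentAt (h : QuadraticRelations L B q R r)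
    (hr : ∀ W W', r W W' = r W' W) {p : Cplx S × Cplx S} (hp : p ∈ quartic S) :
    quadraticField L B q R r p ∈ tangentAt (quarticFun S) p := by
  obtain ⟨Z, W⟩ := p
  have hW : W = ofReal W.re + Complex.I • (Z ^ 2 * conj Z ^ 2) := by
    rw [← (mem_quartic_iff _).1 hp]
    ext <;> simp
  have hV := h.quadratic_im (Z ^ 2 * conj Z ^ 2).re
  rw [ofReal_re_sq_mul_conj_sq] at hV
  rw [hW, quadraticField_mem_tangentAt_iff hr, h.const_im, h.linear_im, h.quadratic_im,
    ← h.linear_eq, ← h.bilinear_eq, h.bilinear_im, hV, ofReal_re, ofReal_re]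
  ring

theorem quadraticRelations_of_eventually_mem_tangentAt (hr : ∀ W W', r W W' = r W' W)
    (h : ∀ᶠ p in 𝓝 0, p ∈ quartic S →
      quadraticField L B q R r p ∈ tangentAt (quarticFun S) p) :
    QuadraticRelations L B q R r := by
  refine quadraticRelations_of_forall hr fun U Z V hV => ?_
  let a : Fin 6 → S := ![q.im, (R (ofReal U)).im, (r (ofReal U) (ofReal U)).im,
    (R V).re - 4 * (L Z * Z * conj Z ^ 2).re,
    2 * (r (ofReal U) V).re - 4 * (B (ofReal U) Z * Z * conj Z ^ 2).re,
    4 * (B V Z * Z * conj Z ^ 2).im - (r V V).im]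
  have hscale (s : ℝ) : ((s : ℂ) • Z) ^ 2 * conj ((s : ℂ) • Z) ^ 2 = ((s ^ 4 : ℝ) : ℂ) • V := by
    rw [hV, conj_smul, Complex.conj_ofReal]
    simp only [Algebra.smul_def, Complex.ofReal_pow, map_pow]
    ring
  have hcurve : Filter.Tendsto (fun s : ℝ => ((s : ℂ) • Z,
      (s : ℂ) • ofReal U + Complex.I • ((s ^ 4 : ℝ) : ℂ) • V)) (𝓝 0) (𝓝 0) :=
    Continuous.tendsto' (by fun_prop) 0 0 (by simp)
  have hsum : ∀ᶠ s : ℝ in 𝓝 0, ∑ i, s ^ (![0, 1, 2, 4, 5, 8] : Fin 6 → ℕ) i • a i = 0 := by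
    filter_upwards [hcurve.eventually h] with s hs
    have hmem : ((s : ℂ) • Z, (s : ℂ) • ofReal U + Complex.I • ((s ^ 4 : ℝ) : ℂ) • V) ∈
        quartic S := by
      rw [← hscale]
      exact mk_add_smul_mem_quartic (by rw [conj_smul, conj_ofReal, Complex.conj_ofReal])
    have htangent := (quadraticField_mem_tangentAt_iff hr).1 (hs hmem)
    simp only [map_smul, LinearMap.smul_apply, conj_smul, Complex.conj_ofReal, smul_pow,
      smul_mul_assoc, mul_smul_comm, smul_smul, ← Complex.ofReal_pow, ← Complex.ofReal_mul,
      smul_re, smul_im, Complex.ofReal_re, Complex.ofReal_im, zero_smul, sub_zero, add_zero]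
      at htangent
    rw [Fin.sum_univ_six, ← htangent]
    simp only [a, Matrix.cons_val, Algebra.smul_def, map_mul, map_pow]
    ring
  have ha := eq_zero_of_infinite_sum_pow_smul_eq_zero (e := ![0, 1, 2, 4, 5, 8]) (by decide)
    (infinite_of_mem_nhds 0 hsum)
  exact ⟨ha 0, ha 1, ha 2, sub_eq_zero.1 (ha 3), sub_eq_zero.1 (ha 4), sub_eq_zero.1 (ha 5)⟩

theorem analyticAt_quadraticField (p : Cplx S × Cplx S) :
    AnalyticAt ℂ (quadraticField L B q R r) p := by
  have hbilin (b : Cplx S →ₗ[ℂ] Cplx S →ₗ[ℂ] Cplx S) {f : Cplx S × Cplx S → Cplx S}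
      (hf : AnalyticAt ℂ f p) : AnalyticAt ℂ (fun p => b p.2 (f p)) p :=
    (LinearMap.toContinuousBilinearMap b).analyticAt_bilinear (p.2, f p) |>.comp₂
      analyticAt_snd hf
  exact (((L.toContinuousLinearMap.analyticAt _).comp analyticAt_fst).add
    (hbilin B analyticAt_fst)).prod ((analyticAt_const.add
      ((R.toContinuousLinearMap.analyticAt _).comp analyticAt_snd)).add (hbilin r analyticAt_snd))

theorem mem_infAut_iff_quadraticRelations (hr : ∀ W W', r W W' = r W' W)
    {X : Cplx S × Cplx S → Cplx S × Cplx S} (hX : ∀ᶠ p in 𝓝 0, X p = quadraticField L B q R r p) :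
    X ∈ infAut (quarticFun S) ↔ QuadraticRelations L B q R r := by
  refine ⟨fun h => quadraticRelations_of_eventually_mem_tangentAt hr ?_, fun h => ⟨?_, ?_⟩⟩
  · filter_upwards [hX, h.2] with p hp htangent hmem
    exact hp ▸ htangent hmem
  · exact (analyticAt_quadraticField 0).congr (hX.mono fun p hp => hp.symm)
  · exact hX.mono fun p hp hmem => hp ▸ h.mem_tangentAt hr hmem

end Relations

section NormalForm

variable {S : Type*} [CommRing S] [Algebra ℝ S]

theorem star_conj_sub_smul_of_mem_quartic {p : Cplx S × Cplx S} (hp : p ∈ quartic S) :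
    star (conj p.1, p.2 - (2 * Complex.I) • (p.1 ^ 2 * conj p.1 ^ 2)) = p := by
  rw [← mem_quartic_iff_sub_conj.1 hp, sub_sub_cancel]
  exact star_star p

variable [FiniteDimensional ℝ S] {X : Cplx S × Cplx S → Cplx S × Cplx S}

theorem eventually_differentiableAt_star_comp_star (hX : AnalyticAt ℂ X 0) :
    ∀ᶠ p in 𝓝 0, DifferentiableAt ℂ (star ∘ X ∘ star) p := by
  have hstar : Filter.Tendsto (star : Cplx S × Cplx S → _) (𝓝 0) (𝓝 0) :=
    Continuous.tendsto' (by fun_prop) 0 0 (star_zero _)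
  filter_upwards [hstar.eventually hX.eventually_analyticAt] with p hp
  exact star_star p ▸ hp.differentiableAt.star_star

theorem eventually_polarized_eq_of_mem_infAut (hX : X ∈ infAut (quarticFun S)) :
    ∀ᶠ v : Cplx S × Cplx S × Cplx S in 𝓝 0,
      (X (v.1, v.2.2)).2 -
          ((star ∘ X ∘ star) (v.2.1, v.2.2 - (2 * Complex.I) • (v.1 ^ 2 * v.2.1 ^ 2))).2 =
        (2 * (2 * Complex.I)) • ((X (v.1, v.2.2)).1 * (v.1 * v.2.1 ^ 2) +
          ((star ∘ X ∘ star) (v.2.1, v.2.2 - (2 * Complex.I) • (v.1 ^ 2 * v.2.1 ^ 2))).1 *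
            (v.2.1 * v.1 ^ 2)) := by
  have hmem : (0 : Cplx S × Cplx S) ∈ quartic S := by simp [mem_quartic_iff_sub_conj]
  have hzero : ((0 : Cplx S × Cplx S).1, conj (0 : Cplx S × Cplx S).1, (0 : Cplx S × Cplx S).2) =
      0 := by simp
  have hleft : Filter.Tendsto (fun v : Cplx S × Cplx S × Cplx S => (v.1, v.2.2)) (𝓝 0) (𝓝 0) :=
    Continuous.tendsto' (by fun_prop) 0 0 rfl
  have hright : Filter.Tendsto (fun v : Cplx S × Cplx S × Cplx S =>
      (v.2.1, v.2.2 - (2 * Complex.I) • (v.1 ^ 2 * v.2.1 ^ 2))) (𝓝 0) (𝓝 0) :=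
    Continuous.tendsto' (by fun_prop) 0 0 (by simp)
  simp only [← sub_eq_zero (a := (X _).2 - _)]
  rw [← hzero]
  refine eventually_eq_zero_of_eventually_mem_quartic hmem ?_ ?_
  · rw [hzero]
    filter_upwards [hleft.eventually hX.1.eventually_analyticAt,
      hright.eventually (eventually_differentiableAt_star_comp_star hX.1)] with v hv hv'
    have hXv : DifferentiableAt ℂ (fun v : Cplx S × Cplx S × Cplx S => X (v.1, v.2.2)) v :=
      hv.differentiableAt.comp v (by fun_prop)
    have hXv' : DifferentiableAt ℂ (fun v : Cplx S × Cplx S × Cplx S =>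
        (star ∘ X ∘ star) (v.2.1, v.2.2 - (2 * Complex.I) • (v.1 ^ 2 * v.2.1 ^ 2))) v :=
      DifferentiableAt.comp (g := star ∘ X ∘ star) v hv' (by fun_prop)
    exact (hXv.snd.fun_sub hXv'.snd).fun_sub (((hXv.fst.fun_mul (by fun_prop)).fun_add
      (hXv'.fst.fun_mul (by fun_prop))).fun_const_smul _)
  · filter_upwards [hX.2] with p htangent hp
    have hvec := mem_tangentAt_quarticFun_iff.1 (htangent hp)
    simp only [Function.comp_apply, star_conj_sub_smul_of_mem_quartic hp,
      Prod.fst_star, Prod.snd_star, ← starRingEnd_apply (R := Cplx S)]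
    simp only [map_mul, map_pow, starRingEnd_self_apply] at hvec
    rw [hvec, ← mul_assoc 2 2, ← mul_assoc, ← mul_assoc]
    norm_num

theorem exists_quadraticField_of_mem_infAut (hX : X ∈ infAut (quarticFun S)) :
    ∃ L B q R r, (∀ W W', r W W' = r W' W) ∧
      ∀ᶠ p in 𝓝 0, X p = quadraticField L B q R r p := by
  obtain ⟨hsnd, hpol⟩ := polarizedTangency_of_eventually (f := fun p => (X p).1)
    (g := fun p => (X p).2) (f' := fun p => ((star ∘ X ∘ star) p).1)
    (g' := fun p => ((star ∘ X ∘ star) p).2) (eventually_polarized_eq_of_mem_infAut hX)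
  let G : Cplx S → Cplx S := fun P => (X (0, P)).2
  let D : Cplx S → Cplx S →L[ℂ] Cplx S := fstDeriv fun p => (X p).1
  have hc : 2 * Complex.I ≠ 0 := by simp
  have hf : AnalyticAt ℂ (fun p => (X p).1) 0 := analyticAt_fst.comp hX.1
  have hf' : ∀ᶠ p in 𝓝 0, DifferentiableAt ℂ (fun p => ((star ∘ X ∘ star) p).1) p :=
    (eventually_differentiableAt_star_comp_star hX.1).mono fun p hp => hp.fst
  have hG : ∀ᶠ P in 𝓝 0, DifferentiableAt ℂ G P := by
    have hin : Filter.Tendsto (fun P : Cplx S => ((0 : Cplx S), P)) (𝓝 0) (𝓝 0) :=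
      Continuous.tendsto' (by fun_prop) 0 0 rfl
    filter_upwards [hin.eventually hX.1.eventually_analyticAt] with P hP
    exact (hP.differentiableAt.comp P (by fun_prop)).snd
  have hproj : Filter.Tendsto (fun p : Cplx S × Cplx S => p.2) (𝓝 0) (𝓝 0) :=
    Continuous.tendsto' (by fun_prop) 0 0 rfl
  let m := (ContinuousLinearMap.mul ℂ (Cplx S)).comp ((fderiv ℂ D 0).flip 1)
  refine ⟨(D 0 : Cplx S →ₗ[ℂ] Cplx S), (fderiv ℂ D 0).toLinearMap₁₂, G 0,
    (fderiv ℂ G 0 : Cplx S →ₗ[ℂ] Cplx S), (m + m.flip).toLinearMap₁₂,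
    fun W W' => add_comm (m W W') (m W' W), ?_⟩
  filter_upwards [hpol.eventually_fst_eq hc hf hf' hG.self_of_nhds, hsnd,
    hproj.eventually (hpol.eventually_snd_eq hc hf hf' hG)] with p h₁ h₂ h₃
  refine Prod.ext h₁ ((h₂.trans h₃).trans ?_)
  exact congrArg _ (two_smul ℂ (m p.2 p.2))

end NormalForm

end

theorem mainTheorem4 (S : Type*) [CommRing S] [Algebra ℝ S] [FiniteDimensional ℝ S] :
    -- (a) nondegeneracy: independence of the coordinates of the form, finite type, and
    -- holomorphic nondegeneracy
    (CoordinatesIndependent (fun Z : Cplx S => (quarticForm S Z (conj Z)).re) ∧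
      (∀ p ∈ quartic S, FiniteTypeAt (quarticFun S) p) ∧
      (∀ p ∈ quartic S, HolNondegenerateAt (quarticFun S) p)) ∧
    -- (b) the full-dimension condition
    FullDimension (quarticForm S) ∧
    -- (c) the description of the infinitesimal automorphisms
    (∀ X : Cplx S × Cplx S → Cplx S × Cplx S, X ∈ infAut (quarticFun S) ↔
      ∃ (L : Cplx S →ₗ[ℂ] Cplx S) (B : Cplx S →ₗ[ℂ] Cplx S →ₗ[ℂ] Cplx S) (q : S)
        (R : Cplx S →ₗ[ℂ] Cplx S) (r : Cplx S →ₗ[ℂ] Cplx S →ₗ[ℂ] Cplx S),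
        (∀ᶠ p in 𝓝 (0 : Cplx S × Cplx S),
          X p = (L p.1 + B p.2 p.1, Cplx.ofReal q + R p.2 + r p.2 p.2)) ∧
        (∀ U : S, (R (Cplx.ofReal U)).im = 0) ∧
        (∀ W W' : Cplx S, r W W' = r W' W) ∧
        (∀ U : S, (r (Cplx.ofReal U) (Cplx.ofReal U)).im = 0) ∧
        (∀ Z : Cplx S,
          Cplx.ofReal (4 * (L Z * Z * conj Z ^ 2).re) = R (Z ^ 2 * conj Z ^ 2)) ∧
        (∀ (U : S) (Z : Cplx S),
          Cplx.ofReal (2 * (B (Cplx.ofReal U) Z * Z * conj Z ^ 2).re) =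
            r (Cplx.ofReal U) (Z ^ 2 * conj Z ^ 2)) ∧
        (∀ Z : Cplx S, (B (Z ^ 2 * conj Z ^ 2) Z * Z * conj Z ^ 2).im = 0)) := by
  refine ⟨⟨coordinatesIndependent_quarticForm S, fun p _ => finiteTypeAt_quarticFun p,
    fun p hp => holNondegenerateAt_quarticFun hp⟩, fullDimension_quarticForm S,
    fun X => ⟨fun hX => ?_, ?_⟩⟩
  · obtain ⟨L, B, q, R, r, hr, hform⟩ := exists_quadraticField_of_mem_infAut hX
    obtain ⟨hq, hR, hrr, hL, hB, hB'⟩ := (mem_infAut_iff_quadraticRelations hr hform).1 hX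
    rw [← Cplx.ofReal_re_eq_self hq] at hform
    exact ⟨L, B, q.re, R, r, hform, hR, hr, hrr, hL, hB, hB'⟩
  · rintro ⟨L, B, q, R, r, hform, hR, hr, hrr, hL, hB, hB'⟩
    exact (mem_infAut_iff_quadraticRelations hr hform).2 ⟨Cplx.ofReal_im q, hR, hrr, hL, hB, hB'⟩
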